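/- \textbf{Definitions.} Let $L_{\mathrm{mt}}=\{<,\sqcap\}$, with $<$ a binary relation symbol and $\sqcap$ a binary function symbol. The theory $\mathsf{DMT}$ of dense meet-trees is the $L_{\mathrm{mt}}$-theory saying that: $<$ is a strict partial order in which any two elements of a set $\{x\mid x<a\}$ are comparable, and $a\sqcap b$ is the greatest common lower bound of $a$ and $b$; for every $a$, the set $\{x\mid x<a\}$ is a nonempty dense linear order without endpoints; for every $a$ there are infinitely many open cones above $a$, i.e. infinitely many classes of the equivalence relation $x\sqcap y>a$ on $\{x\mid x>a\}$. Write $x\parallel y$ if $x,y$ are incomparable. A \emph{binary cone-expansion} of $\mathsf{DMT}$ is a complete theory $T\supseteq\mathsf{DMT}$ with quantifier elimination in a language $L=L_{\mathrm{mt}}\cup\{R_j,P_{j'}\mid j\in J,\ j'\in J'\}$, where the $P_{j'}$ are unary and the $R_j$ are binary relation symbols, and every $R_j$ is on open cones: $T$ proves that $R_j(x,y)$ implies $x\parallel y$, and that if $x\parallel y$, $x\sqcap x'>x\sqcap y$ and $y\sqcap y'>x\sqcap y$, then $R_j(x,y)\leftrightarrow R_j(x',y')$. The theory $\mathsf{DTR}$,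 in the language with a single binary relation $R$ and no unary predicates besides $L_{\mathrm{mt}}$, says that the $L_{\mathrm{mt}}$-reduct is a model of $\mathsf{DMT}$, that $R$ is on open cones, and that for every $g$ the structure induced by $R$ on the set of open cones above $g$ is a graph elementarily equivalent to the random graph (distinct open cones $C,D$ above $g$ are adjacent if $R(x,y)$ holds for $x\in C$, $y\in D$). Let $T$ be a theory, $\kappa>|L|+\aleph_0$ a cardinal, and $\mathfrak U$ a $\kappa$-saturated and $\kappa$-strongly homogeneous model of $T$; a set is \emph{small} if its cardinality is less than $\kappa$. If $a$ is a finite tuple in an elementary extension of $\mathfrak U$, then $\mathrm{tp}(a/\mathfrak U)$ is \emph{invariant} if there is a small $B\subseteq\mathfrak U$ such that, for all formulas $\varphi(x;y)$ and all tuples $d,e$ of $\mathfrak U$ with the same type over $B$, $\varphi(x;d)\in\mathrm{tp}(a/\mathfrak U)$ iff $\varphi(x;e)\in\mathrm{tp}(a/\mathfrak U)$. The theory $T$ is \emph{weakly binary} if for every such $\kappa$ and $\mathfrak U$ and all finite tuples $a,b$ in an elementary extension of $\mathfrak U$ such that $\mathrm{tp}(a/\mathfrak U)$ and $\mathrm{tp}(b/\mathfrak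 U)$ are invariant, there is a small $A\subseteq\mathfrak U$ such that \[\mathrm{tp}(a/\mathfrak U)\cup\mathrm{tp}(b/\mathfrak U)\cup\mathrm{tp}(ab/A)\vdash\mathrm{tp}(ab/\mathfrak U).\tag{$\dagger$}\] \textbf{Theorem.} Every binary cone-expansion of $\mathsf{DMT}$ is weakly binary. In particular, $\mathsf{DMT}$ and $\mathsf{DTR}$ are weakly binary. Moreover, in each of these theories, for every such $\mathfrak U$ and \emph{all} finite tuples $a,b$ in an elementary extension of $\mathfrak U$ (without assuming invariance), there is a small $A\subseteq\mathfrak U$ such that $(\dagger)$ holds. -/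

import Mathlib

universe u v w

namespace ConeExpansion

open FirstOrder FirstOrder.Language Cardinal

/-! ### Languages of meet-trees with additional unary and binary predicates -/

/-- The function symbols: one binary symbol for the meet `x ⊓ y`. -/
inductive Func : ℕ → Type
  | meet : Func 2

/-- The relation symbols: the strict order `<`, the binary symbols `R j` for `j : J`, and the unary
symbols `P j'` for `j' : J'`. -/
inductive Rel (J : Type u) (J' : Type v) : ℕ → Type (max u v)
  | lt : Rel J J' 2
  | R (j : J) : Rel J J' 2
  | P (j' : J') : Rel J J' 1

/-- The language `{<, ⊓} ∪ {R j, P j' | j ∈ J, j' ∈ J'}`. -/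
def lang (J : Type u) (J' : Type v) : FirstOrder.Language.{0, max u v} := ⟨Func, Rel J J'⟩

/-- The symbol for the meet. -/
abbrev meetSymb {J : Type u} {J' : Type v} : (lang J J').Functions 2 := Func.meet

/-- The symbol `<`. -/
abbrev ltSymb {J : Type u} {J' : Type v} : (lang J J').Relations 2 := Rel.lt

/-- The symbol `R j`. -/
abbrev relSymb {J : Type u} {J' : Type v} (j : J) : (lang J J').Relations 2 := Rel.R j

/-- The language `{<, ⊓}` of meet-trees. -/
abbrev Lmt : FirstOrder.Language.{0, 0} := lang Empty Empty

section Formulas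

variable {J : Type u} {J' : Type v} {α : Type w} {n : ℕ}

/-- The term `s ⊓ t`. -/
def meetT (s t : (lang J J').Term α) : (lang J J').Term α :=
  meetSymb.apply₂ s t

/-- The formula `s < t`. -/
def ltF (s t : (lang J J').Term (α ⊕ Fin n)) : (lang J J').BoundedFormula α n :=
  ltSymb.boundedFormula₂ s t

/-- The formula `s ≤ t`. -/
def leF (s t : (lang J J').Term (α ⊕ Fin n)) : (lang J J').BoundedFormula α n :=
  ltF s t ⊔ s =' t

/-- The formula `s ∥ t`: the elements `s` and `t` are incomparable. -/
def parF (s t : (lang J J').Term (α ⊕ Fin n)) : (lang J J').BoundedFormula α n :=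
  ∼(leF s t) ⊓ ∼(leF t s)

/-- The formula `R j (s, t)`. -/
def relF (j : J) (s t : (lang J J').Term (α ⊕ Fin n)) : (lang J J').BoundedFormula α n :=
  (relSymb j).boundedFormula₂ s t

/-- A free variable, as a term usable in a formula. -/
def fv (a : α) : (lang J J').Term (α ⊕ Fin 0) := Term.var (Sum.inl a)

end Formulas

/-! ### Dense meet-trees -/

section Axioms

variable (J : Type u) (J' : Type v)

/-- `(M, <)` is a strict partial order, it is lower semilinear, and `x ⊓ y` is the greatest common
lower bound of `x` and `y`. -/
def meetTreeAxioms : (lang J J').Theory :=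
  { ∀' ∼(ltF &0 &0),
    ∀' ∀' ∀' (ltF &0 &1 ⊓ ltF &1 &2 ⟹ ltF &0 &2),
    ∀' ∀' ∀' (ltF &0 &2 ⊓ ltF &1 &2 ⟹ leF &0 &1 ⊔ leF &1 &0),
    ∀' ∀' (leF (meetT (&0) (&1)) &0 ⊓ leF (meetT (&0) (&1)) &1),
    ∀' ∀' ∀' (leF &2 &0 ⊓ leF &2 &1 ⟹ leF &2 (meetT (&0) (&1))) }

/-- For every `a`, the set of elements below `a` is nonempty, has no least element (both follow from
the first sentence), and is densely ordered without a greatest element (second sentence). -/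
def densityAxioms : (lang J J').Theory :=
  { ∀' ∃' ltF &1 &0,
    ∀' ∀' (ltF &0 &1 ⟹ ∃' (ltF &0 &2 ⊓ ltF &2 &1)) }

/-- For every `a` there are `n` distinct open cones above `a`: elements `x 0, …, x (n - 1)` above
`a` such that `a < x i ⊓ x k` fails whenever `i ≠ k`. -/
noncomputable def manyCones (n : ℕ) : (lang J J').Sentence :=
  let a : (lang J J').Term (((Empty ⊕ Unit) ⊕ Fin n) ⊕ Fin 0) := fv (Sum.inl (Sum.inr ()))
  let x : Fin n → (lang J J').Term (((Empty ⊕ Unit) ⊕ Fin n) ⊕ Fin 0) := fun i => fv (Sum.inr i)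
  Formula.iAlls Unit (Formula.iExs (Fin n)
    (BoundedFormula.iInf (fun i => ltF a (x i)) ⊓
      BoundedFormula.iInf (fun p : {p : Fin n × Fin n // p.1 ≠ p.2} =>
        ∼(ltF a (meetT (x p.1.1) (x p.1.2))))))

/-- The axioms of dense meet-trees, as a theory in the language with symbols `R j` and `P j'`
(about which nothing is said). -/
def dmtAxioms : (lang J J').Theory :=
  meetTreeAxioms J J' ∪ densityAxioms J J' ∪ Set.range (manyCones J J')

/-- Every `R j` is on open cones: `R j (x, y)` implies `x ∥ y`; and if `x ∥ y`, `x ⊓ x' > x ⊓ y` and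
`y ⊓ y' > x ⊓ y`, then `R j (x, y) ↔ R j (x', y')`. -/
def onOpenConesAxioms : (lang J J').Theory :=
  Set.range (fun j : J => ∀' ∀' (relF j &0 &1 ⟹ parF &0 &1)) ∪
  Set.range (fun j : J => ∀' ∀' ∀' ∀'
    (parF &0 &1 ⊓ (ltF (meetT (&0) (&1)) (meetT (&0) (&2)) ⊓
        ltF (meetT (&0) (&1)) (meetT (&1) (&3))) ⟹
      (relF j &0 &1 ⇔ relF j &2 &3)))

end Axioms

/-- The theory of dense meet-trees. -/
def DMT : Lmt.Theory := dmtAxioms Empty Empty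

/-! ### Binary cone-expansions -/

/-- `T` eliminates quantifiers. -/
def EliminatesQuantifiers {L : FirstOrder.Language.{u, v}} (T : L.Theory) : Prop :=
  ∀ (n : ℕ) (φ : L.Formula (Fin n)), ∃ ψ : L.Formula (Fin n),
    BoundedFormula.IsQF ψ ∧ (φ ⇔[T] ψ)

/-- Binary cone-expansions of the theory of dense meet-trees. -/
structure IsBinaryConeExpansion {J : Type u} {J' : Type v} (T : (lang J J').Theory) : Prop where
  complete : T.IsComplete
  models_dmt : ∀ φ ∈ dmtAxioms J J', T ⊨ᵇ φ
  eliminatesQuantifiers : EliminatesQuantifiers T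
  onOpenCones : ∀ φ ∈ onOpenConesAxioms J J', T ⊨ᵇ φ

/-! ### The theory `DTR` -/

/-- The relation `R` is symmetric. -/
def symmAxiom : (lang Unit Empty).Sentence :=
  ∀' ∀' (relF () &0 &1 ⟹ relF () &1 &0)

/-- The extension axioms of the random graph, for the graph induced by `R` on the set of open cones
above any `g`: if `x 0, …, x (n - 1), y 0, …, y (m - 1)` are above `g` and no `x i` is in the
same open cone above `g` as some `y k`, then there is `z` above `g` whose open cone is different
from those of all the `x i` and `y k`, is `R`-related to the cone of each `x i`, and is not
`R`-related to the cone of any `y k`. -/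
noncomputable def randomConesAxiom (n m : ℕ) : (lang Unit Empty).Sentence :=
  let V := (Empty ⊕ (Unit ⊕ (Fin n ⊕ Fin m)))
  let g : V := Sum.inr (Sum.inl ())
  let x : Fin n → V := fun i => Sum.inr (Sum.inr (Sum.inl i))
  let y : Fin m → V := fun k => Sum.inr (Sum.inr (Sum.inr k))
  let z : V ⊕ Unit := Sum.inr ()
  Formula.iAlls (Unit ⊕ (Fin n ⊕ Fin m))
    ((BoundedFormula.iInf (fun i => ltF (fv g) (fv (x i))) ⊓
      (BoundedFormula.iInf (fun k => ltF (fv g) (fv (y k))) ⊓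
        BoundedFormula.iInf (fun p : Fin n × Fin m =>
          ∼(ltF (fv g) (meetT (fv (x p.1)) (fv (y p.2))))))) ⟹
    Formula.iExs Unit
      (ltF (fv (Sum.inl g)) (fv z) ⊓
        (BoundedFormula.iInf (fun i =>
            ∼(ltF (fv (Sum.inl g)) (meetT (fv z) (fv (Sum.inl (x i))))) ⊓
              relF () (fv z) (fv (Sum.inl (x i)))) ⊓
          BoundedFormula.iInf (fun k =>
            ∼(ltF (fv (Sum.inl g)) (meetT (fv z) (fv (Sum.inl (y k))))) ⊓
              ∼(relF () (fv z) (fv (Sum.inl (y k))))))))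

/-- The theory `DTR` of dense meet-trees with a binary relation `R` on open cones that, for every
`g`, induces on the set of open cones above `g` a graph elementarily equivalent to the random
graph. -/
def DTR : (lang Unit Empty).Theory :=
  dmtAxioms Unit Empty ∪ onOpenConesAxioms Unit Empty ∪ {symmAxiom} ∪
    {φ | ∃ n m : ℕ, φ = randomConesAxiom n m}

/-! ### Monster models, types, and weak binarity

A formula over a parameter set `A` in variables indexed by `α` is represented as a formula whose free
variables are indexed by `A ⊕ α`, where each variable in `A` is to be interpreted as the
corresponding parameter. -/

section Types

variable {L : FirstOrder.Language.{u, v}}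

/-- `U` is `κ`-saturated: every set of formulas in finitely many variables with parameters in a set
of size less than `κ` which is finitely satisfiable in `U` is realised in `U`. -/
def IsSaturated (L : FirstOrder.Language.{u, v}) (U : Type w) [L.Structure U] (κ : Cardinal.{w}) : Prop :=
  ∀ A : Set U, #A < κ → ∀ (n : ℕ) (Γ : Set (L.Formula (A ⊕ Fin n))),
    (∀ Δ : Finset (L.Formula (A ⊕ Fin n)), (Δ : Set (L.Formula (A ⊕ Fin n))) ⊆ Γ →
      ∃ a : Fin n → U, ∀ φ ∈ Δ, φ.Realize (Sum.elim Subtype.val a)) →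
    ∃ a : Fin n → U, ∀ φ ∈ Γ, φ.Realize (Sum.elim Subtype.val a)

/-- `U` is `κ`-strongly homogeneous: every partial elementary map from a subset of size less than `κ`
extends to an automorphism of `U`. -/
def IsStronglyHomogeneous (L : FirstOrder.Language.{u, v}) (U : Type w) [L.Structure U] (κ : Cardinal.{w}) :
    Prop :=
  ∀ A : Set U, #A < κ → ∀ f : A → U,
    (∀ φ : L.Formula A, φ.Realize (Subtype.val : A → U) ↔ φ.Realize f) →
    ∃ σ : U ≃[L] U, ∀ a : A, σ a = f a

variable {U : Type w} [L.Structure U] {N : Type (max u v w)} [L.Structure N]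

/-- The type over `A ⊆ U` of a tuple `a` in an elementary extension `N` of `U`, as a set of formulas
with parameters in `U` (which in fact lie in `A`). -/
def tp {α : Type} (ι : U ↪ₑ[L] N) (A : Set U) (a : α → N) : Set (L.Formula (U ⊕ α)) :=
  {ψ | ∃ φ : L.Formula (A ⊕ α), φ.Realize (Sum.elim (fun c : A => ι c) a) ∧
    ψ = φ.relabel (Sum.map Subtype.val id)}

/-- The type of `a` over `U` is `A`-invariant: for all formulas `φ(x; y)` and all tuples `d`, `e` in
`U` with the same type over `A`, the formula `φ(x; d)` is in the type iff `φ(x; e)` is. -/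
def TypeIsInvariantOver {n : ℕ} (ι : U ↪ₑ[L] N) (A : Set U) (a : Fin n → N) : Prop :=
  ∀ (k : ℕ) (φ : L.Formula (Fin n ⊕ Fin k)) (d e : Fin k → U),
    (∀ ψ : L.Formula (A ⊕ Fin k),
      ψ.Realize (Sum.elim Subtype.val d) ↔ ψ.Realize (Sum.elim Subtype.val e)) →
    (φ.Realize (Sum.elim a (fun i => ι (d i))) ↔ φ.Realize (Sum.elim a (fun i => ι (e i))))

/-- `Γ ⊢ Δ`: whenever an assignment in an `L`-structure satisfies all formulas in `Γ`, it satisfies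
all formulas in `Δ`. (The structures range over a universe that contains structures of all
cardinalities up to that of the set of formulas.) -/
def Entails {V : Type w} (Γ Δ : Set (L.Formula V)) : Prop :=
  ∀ (M : Type (max u v w)) [L.Structure M] [Nonempty M] (s : V → M),
    (∀ φ ∈ Γ, φ.Realize s) → ∀ ψ ∈ Δ, ψ.Realize s

/-- `tp(a/U) ∪ tp(b/U) ∪ tp(ab/A) ⊢ tp(ab/U)`, where `tp(a/U)` is taken in the variables indexed by
`Fin m` and `tp(b/U)` in those indexed by `Fin n`. -/
def DeterminedBy {m n : ℕ} (ι : U ↪ₑ[L] N) (A : Set U) (a : Fin m → N) (b : Fin n → N) : Prop :=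
  Entails
    (Formula.relabel (Sum.map id Sum.inl) '' tp ι Set.univ a ∪
      Formula.relabel (Sum.map id Sum.inr) '' tp ι Set.univ b ∪
      tp ι A (Sum.elim a b))
    (tp ι Set.univ (Sum.elim a b))

end Types

/-- `U` is a monster model of `T` with respect to the cardinal `κ`; a set is then small if it has
fewer than `κ` elements. -/
structure IsMonster {L : FirstOrder.Language.{u, v}} (T : L.Theory) (U : Type w) [L.Structure U]
    (κ : Cardinal.{w}) : Prop where
  nonempty : Nonempty U
  models : U ⊨ T
  aleph0_lt : ℵ₀ < κ
  card_lt : Cardinal.lift.{w} L.card < Cardinal.lift.{max u v} κ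
  saturated : IsSaturated L U κ
  stronglyHomogeneous : IsStronglyHomogeneous L U κ

/-- `T` is weakly binary: for every monster model `U` and all tuples `a`, `b` in an elementary
extension of `U` whose types over `U` are invariant (over some small sets), there is a small `A`
such that `tp(a/U) ∪ tp(b/U) ∪ tp(ab/A) ⊢ tp(ab/U)`. -/
def IsWeaklyBinary {L : FirstOrder.Language.{u, v}} (T : L.Theory) : Prop :=
  ∀ (κ : Cardinal.{w}) (U : Type w) [L.Structure U], IsMonster T U κ →
  ∀ (N : Type (max u v w)) [L.Structure N] (ι : U ↪ₑ[L] N)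
    (m n : ℕ) (a : Fin m → N) (b : Fin n → N),
    (∃ B : Set U, #B < κ ∧ TypeIsInvariantOver ι B a) →
    (∃ B : Set U, #B < κ ∧ TypeIsInvariantOver ι B b) →
    ∃ A : Set U, #A < κ ∧ DeterminedBy ι A a b

/-- The strengthening of weak binarity in which the tuples `a`, `b` are arbitrary. -/
def IsWeaklyBinaryForAllTuples {L : FirstOrder.Language.{u, v}} (T : L.Theory) : Prop :=
  ∀ (κ : Cardinal.{w}) (U : Type w) [L.Structure U], IsMonster T U κ →
  ∀ (N : Type (max u v w)) [L.Structure N] (ι : U ↪ₑ[L] N)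
    (m n : ℕ) (a : Fin m → N) (b : Fin n → N),
    ∃ A : Set U, #A < κ ∧ DeterminedBy ι A a b

end ConeExpansion

universe x

/-! In a meet-tree the elements below a fixed one form a chain, so every meet of finitely many
elements is already a meet of two of them. Once atomic formulas determine types, a type is therefore
known from `≤`, `R j` and `P j'` on meets of pairs.

Given `a` and `b`, the set `A` can be taken finite. For each `a i`, all meets of `a i` with elements
of `U` that fall outside `U` coincide (`exists_inf_eq_of_notMem_range`), so one parameter `ca i`
produces them all. Hence the closure of `U` and `a` under meets is `U` together with a finite set
`FA` of meets of `a` and the `ca i`; likewise `FB` for `b`. Besides these parameters, `A` contains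
the largest element of `U` below `p ⊓ q`, for `p` in `FA` and `q` in `FB`, whenever there is one.

Every element generated by `U`, `a` and `b` is then in `U`, in `FA` or `FB`, or of the form `p ⊓ q`.
Relations inside `U` are known, those between elements of the last three kinds belong to `tp(ab/A)`,
and those between `U` and `FA` or `FB` to the type of one component. What remains is an `r` in `U`
against `p ⊓ q`, which is the content of `IsAmalgam.agree_inf`. There the order is settled by the
meets `r ⊓ p` and `r ⊓ q` and by the cut of `p ⊓ q` over `U`. The `R j` hold only between
incomparable elements and depend only on open cones, so `p ⊓ q` can be replaced by `p`.

For a binary cone-expansion, quantifier elimination makes atomic formulas determine types. For `DMT`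
and `DTR` this comes from a back-and-forth between finite substructures: to add a point, add first
its largest meet with the substructure, then a new open cone above that meet. -/

namespace ConeExpansion

open FirstOrder FirstOrder.Language Cardinal

/-! ### Meet-trees as semilattices -/

section ConeTree

variable {J : Type u} {J' : Type v} {M : Type w} {N : Type x}

/-- The interpretation of `R j`. -/
def relOn (J' : Type v) [(lang J J').Structure M] (j : J) (a b : M) : Prop :=
  Structure.RelMap (relSymb j : (lang J J').Relations 2) ![a, b]

/-- The symbol `P j'`. -/
abbrev unSymb (j' : J') : (lang J J').Relations 1 := Rel.P j'

/-- The interpretation of `P j'`. -/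
def unOn (J : Type u) [(lang J J').Structure M] (j' : J') (a : M) : Prop :=
  Structure.RelMap (unSymb j' : (lang J J').Relations 1) ![a]

/-- The order and the meet of the semilattice `M` are those of the structure `M`, which is a
meet-tree with all `R j` on open cones. -/
class IsConeTree (J : Type u) (J' : Type v) (M : Type w) [SemilatticeInf M]
    [(lang J J').Structure M] : Prop where
  relMap_lt : ∀ a b : M,
    Structure.RelMap (ltSymb : (lang J J').Relations 2) ![a, b] ↔ a < b
  funMap_meet : ∀ a b : M,
    Structure.funMap (meetSymb : (lang J J').Functions 2) ![a, b] = a ⊓ b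
  comparable : ∀ {a b c : M}, a ≤ c → b ≤ c → a ≤ b ∨ b ≤ a
  not_le_of_rel : ∀ {j : J} {a b : M}, relOn J' j a b → ¬a ≤ b ∧ ¬b ≤ a
  rel_congr : ∀ (j : J) {a b a' b' : M}, ¬a ≤ b → ¬b ≤ a → a ⊓ b < a ⊓ a' → a ⊓ b < b ⊓ b' →
    (relOn J' j a b ↔ relOn J' j a' b')

theorem exists_isConeTree [(lang J J').Structure M] (h : M ⊨ meetTreeAxioms J J')
    (hc : M ⊨ onOpenConesAxioms J J') : ∃ _ : SemilatticeInf M, IsConeTree J J' M := by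
  simp only [meetTreeAxioms, onOpenConesAxioms, Theory.model_iff, Set.mem_insert_iff,
    Set.mem_singleton_iff, forall_eq, Set.mem_union, or_imp, forall_and,
    Set.forall_mem_range] at h hc
  obtain ⟨h1, h2, h3, h4, h5⟩ := h
  obtain ⟨h6, h7⟩ := hc
  simp [Sentence.Realize, Formula.Realize, ltF, leF, parF, relF, meetT, BoundedFormula.realize_rel₂, Fin.snoc] at h1 h2 h3 h4 h5 h6 h7
  let tree : SemilatticeInf M :=
    { le := fun a b => Structure.RelMap (ltSymb : (lang J J').Relations 2) ![a, b] ∨ a = b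
      lt := fun a b => Structure.RelMap (ltSymb : (lang J J').Relations 2) ![a, b]
      le_refl := fun a => Or.inr rfl
      le_trans := by
        rintro a b c (hab | rfl) (hbc | rfl)
        · exact Or.inl (h2 _ _ _ hab hbc)
        · exact Or.inl hab
        · exact Or.inl hbc
        · exact Or.inr rfl
      lt_iff_le_not_ge := by
        refine fun a b => ⟨fun hab => ⟨Or.inl hab, ?_⟩, ?_⟩
        · rintro (hba | rfl)
          · exact h1 _ (h2 _ _ _ hab hba)
          · exact h1 _ hab
        · rintro ⟨hab | rfl, hba⟩
          · exact hab
          · exact (hba (Or.inr rfl)).elim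
      le_antisymm := by
        rintro a b (hab | rfl) (hba | hba)
        · exact (h1 _ (h2 _ _ _ hab hba)).elim
        · exact hba.symm
        · rfl
        · rfl
      inf := fun a b => Structure.funMap (meetSymb : (lang J J').Functions 2) ![a, b]
      inf_le_left := fun a b => (h4 a b).1
      inf_le_right := fun a b => (h4 a b).2
      le_inf := fun a b c => h5 b c a }
  refine ⟨tree, ⟨fun _ _ => Iff.rfl, fun _ _ => rfl, ?_, ?_, ?_⟩⟩
  · rintro a b c (hac | rfl) (hbc | rfl)
    · exact h3 _ _ _ hac hbc
    · exact Or.inl (Or.inl hac)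
    · exact Or.inr (Or.inl hbc)
    · exact Or.inl (Or.inr rfl)
  · intro j a b hab
    have := h6 j a b hab
    exact ⟨not_or.2 this.1, not_or.2 this.2⟩
  · intro j a b a' b' hab hba ha hb
    exact h7 j a b a' b' (not_or.1 hab).1 (not_or.1 hab).2 (not_or.1 hba).1 (not_or.1 hba).2 ha hb

theorem Term.meet_induction {α : Type*} {P : (lang J J').Term α → Prop}
    (var : ∀ a, P (Term.var a)) (meet : ∀ s t, P s → P t → P (meetT s t)) (t) : P t := by
  induction t with
  | var a => exact var a
  | func f ts ih =>
    cases f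
    convert meet (ts 0) (ts 1) (ih 0) (ih 1) using 2
    unfold meetT Functions.apply₂
    congr 1
    funext i
    fin_cases i <;> rfl

variable [SemilatticeInf M] [(lang J J').Structure M] [SemilatticeInf N] [(lang J J').Structure N]

variable (J J') in
theorem IsConeTree.inf_inf_eq [IsConeTree J J' M] (a b c : M) :
    a ⊓ b ⊓ (a ⊓ c) = a ⊓ b ∨ a ⊓ b ⊓ (a ⊓ c) = a ⊓ c := by
  rcases IsConeTree.comparable J J' (inf_le_left : a ⊓ b ≤ a) (inf_le_left : a ⊓ c ≤ a) with h | h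
  · exact Or.inl (inf_eq_left.2 h)
  · exact Or.inr (inf_eq_right.2 h)

@[simp]
theorem realize_meetT [IsConeTree J J' M] {α : Type*} (s t : (lang J J').Term α) (f : α → M) :
    (meetT s t).realize f = s.realize f ⊓ t.realize f := by
  simp [meetT, IsConeTree.funMap_meet]

/-- In a meet-tree, every term is the meet of two variables. -/
theorem exists_realize_eq_inf [IsConeTree J J' M] {α : Type*} (f : α → M)
    (t : (lang J J').Term α) : ∃ a b, t.realize f = f a ⊓ f b := by
  induction t using Term.meet_induction with
  | var a => exact ⟨a, a, by simp⟩
  | meet s t hs ht =>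
    obtain ⟨a, b, hab⟩ := hs
    obtain ⟨c, d, hcd⟩ := ht
    -- The four-fold meet is rewritten as a meet of three elements below `f a`; these form a chain,
    -- so the least of them is the value.
    have : (meetT s t).realize f = f a ⊓ f b ⊓ (f a ⊓ f c ⊓ (f a ⊓ f d)) := by
      rw [realize_meetT, hab, hcd]
      apply le_antisymm
      · simp only [le_inf_iff]
        refine ⟨⟨?_, ?_⟩, ⟨?_, ?_⟩, ?_, ?_⟩ <;>
        grind [inf_le_left, inf_le_right, le_trans]
      · simp only [le_inf_iff]
        refine ⟨⟨?_, ?_⟩, ?_, ?_⟩ <;>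
        grind [inf_le_left, inf_le_right, le_trans]
    rw [this]
    rcases IsConeTree.inf_inf_eq J J' (f a) (f c) (f d) with h | h <;> rw [h]
    · rcases IsConeTree.inf_inf_eq J J' (f a) (f b) (f c) with h | h <;> rw [h] <;> exact ⟨_, _, rfl⟩
    · rcases IsConeTree.inf_inf_eq J J' (f a) (f b) (f d) with h | h <;> rw [h] <;> exact ⟨_, _, rfl⟩

/-- The relation symbols do not distinguish the first components of the pairs `p`, `q` from the
second ones. -/
structure Agree (J : Type u) (J' : Type v) [(lang J J').Structure M] [(lang J J').Structure N]
    (p q : N × M) : Prop where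
  le_iff : p.1 ≤ q.1 ↔ p.2 ≤ q.2
  rel_iff : ∀ j : J, relOn J' j p.1 q.1 ↔ relOn J' j p.2 q.2
  un_iff : ∀ j' : J', unOn J j' p.1 ↔ unOn J j' p.2

/-- The values of a term under two assignments. -/
def pairVal {α : Type*} (f : α → N) (g : α → M) (t : (lang J J').Term α) : N × M :=
  (t.realize f, t.realize g)

theorem pairVal_meetT [IsConeTree J J' M] [IsConeTree J J' N] {α : Type*} (f : α → N) (g : α → M)
    (s t : (lang J J').Term α) : pairVal f g (meetT s t) = pairVal f g s ⊓ pairVal f g t := by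
  simp [pairVal]

/-- Agreement in both directions makes the correspondence between first and second components
single-valued, so identities between terms need only be checked in one structure. -/
theorem Agree.eq_of_fst_eq {p q : N × M} (h : Agree J J' p q) (h' : Agree J J' q p)
    (e : p.1 = q.1) : p = q :=
  Prod.ext e (le_antisymm (h.le_iff.1 e.le) (h'.le_iff.1 e.ge))

theorem Agree.eq_of_snd_eq {p q : N × M} (h : Agree J J' p q) (h' : Agree J J' q p)
    (e : p.2 = q.2) : p = q :=
  Prod.ext (le_antisymm (h.le_iff.2 e.le) (h'.le_iff.2 e.ge)) e

theorem realize_atomic_iff_of_agree [IsConeTree J J' M] [IsConeTree J J' N] {α : Type*} {n : ℕ}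
    {f : α → N} {g : α → M} {fs : Fin n → N} {gs : Fin n → M}
    (h : ∀ s t : (lang J J').Term (α ⊕ Fin n),
      Agree J J' (pairVal (Sum.elim f fs) (Sum.elim g gs) s)
        (pairVal (Sum.elim f fs) (Sum.elim g gs) t))
    {φ : (lang J J').BoundedFormula α n} (hφ : φ.IsAtomic) : φ.Realize f fs ↔ φ.Realize g gs := by
  cases hφ with
  | equal s t =>
    simp only [BoundedFormula.realize_bdEqual]
    have h1 := h s t
    have h2 := h t s
    exact ⟨fun e => congrArg Prod.snd (h1.eq_of_fst_eq h2 e),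
      fun e => congrArg Prod.fst (h1.eq_of_snd_eq h2 e)⟩
  | rel R ts =>
    have vec2 : ∀ {X : Type _} (e : Fin 2 → X), e = ![e 0, e 1] := fun e => by
      funext i; fin_cases i <;> rfl
    have vec2' : ∀ {X : Type _} (e : Fin 2 → X), e = ![e 0, e 1] := fun e => by
      funext i; fin_cases i <;> rfl
    simp only [BoundedFormula.realize_rel]
    cases R with
    | lt =>
      rw [vec2 fun i => (ts i).realize (Sum.elim f fs), vec2' fun i => (ts i).realize (Sum.elim g gs)]
      have h1 := h (ts 0) (ts 1)
      have h2 := h (ts 1) (ts 0)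
      refine (IsConeTree.relMap_lt _ _).trans (Iff.trans ?_ (IsConeTree.relMap_lt _ _).symm)
      rw [lt_iff_le_not_ge, lt_iff_le_not_ge]
      exact and_congr h1.le_iff (not_congr h2.le_iff)
    | R j =>
      rw [vec2 fun i => (ts i).realize (Sum.elim f fs), vec2' fun i => (ts i).realize (Sum.elim g gs)]
      exact (h (ts 0) (ts 1)).rel_iff j
    | P j' =>
      have := (h (ts 0) (ts 0)).un_iff j'
      rw [unOn, unOn] at this
      convert this using 2
      · funext i; fin_cases i; rfl
      · funext i; fin_cases i; rfl

theorem agree_pairVal [IsConeTree J J' M] [IsConeTree J J' N] {α : Type*}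
    {f : α → N} {g : α → M}
    (h : ∀ φ : (lang J J').Formula α, BoundedFormula.IsAtomic φ → (φ.Realize f ↔ φ.Realize g)) (s t : (lang J J').Term α) :
    Agree J J' (pairVal f g s) (pairVal f g t) := by
  refine ⟨?_, fun j => ?_, fun j' => ?_⟩
  -- The order is read off from the atomic formula `s ⊓ t = s`.
  · have := h ((meetT s t).equal s) (.equal _ _)
    simpa [pairVal] using this
  · have := h ((relSymb j).formula₂ s t) (.rel _ _)
    simpa [relOn, pairVal, Formula.realize_rel₂] using this
  · have := h ((unSymb j').formula₁ s) (.rel _ _)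
    simpa [unOn, pairVal, Formula.realize_rel₁] using this

end ConeTree

/-! ### Amalgamating two extensions of a meet-tree -/

section Amalgam

variable {J : Type u} {J' : Type v} {M : Type w} {N : Type x}
variable [SemilatticeInf M] [(lang J J').Structure M] [SemilatticeInf N] [(lang J J').Structure N]

/-- Going up from `b` stays in the same open cone above `a ⊓ b`. -/
theorem IsConeTree.rel_iff_of_le_right [IsConeTree J J' M] (j : J) {a b b' : M} (h : ¬a ≤ b)
    (h' : ¬b ≤ a) (hb : b ≤ b') : relOn J' j a b ↔ relOn J' j a b' := by
  refine IsConeTree.rel_congr j h h' ?_ ?_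
  · rw [inf_idem]; exact inf_lt_left.2 h
  · rw [inf_eq_left.2 hb]; exact inf_lt_right.2 h'

theorem IsConeTree.rel_iff_of_le_left [IsConeTree J J' M] (j : J) {a a' b : M} (h : ¬a ≤ b)
    (h' : ¬b ≤ a) (ha : a ≤ a') : relOn J' j a b ↔ relOn J' j a' b := by
  refine IsConeTree.rel_congr j h h' ?_ ?_
  · rw [inf_eq_left.2 ha]; exact inf_lt_left.2 h
  · rw [inf_idem]; exact inf_lt_right.2 h'

-- If, say, `c ⊓ a < c ⊓ b`, then `a ⊓ b` and `c ⊓ b` are comparable, both being below `b`; as `c ⊓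
-- b ≤ a ⊓ b` would give `c ⊓ b ≤ c ⊓ a`, the meet `a ⊓ b` is below `c`.
variable (J J') in
theorem IsConeTree.inf_le_of_inf_ne [IsConeTree J J' M] {a b c : M} (h : c ⊓ a ≠ c ⊓ b) :
    a ⊓ b ≤ c := by
  have key : ∀ {a b : M}, c ⊓ a < c ⊓ b → a ⊓ b ≤ c := by
    intro a b hab
    rcases IsConeTree.comparable J J' (inf_le_right : a ⊓ b ≤ b) (inf_le_right : c ⊓ b ≤ b) with h | h
    · exact h.trans inf_le_left
    · exact (hab.not_ge (le_inf inf_le_left (h.trans inf_le_left))).elim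
  rcases IsConeTree.comparable J J' (inf_le_left : c ⊓ a ≤ c) (inf_le_left : c ⊓ b ≤ c) with h' | h'
  · exact key (lt_of_le_of_ne h' h)
  · rw [inf_comm]; exact key (lt_of_le_of_ne h' h.symm)

/-- Two extensions `SA`, `SB` of `U`, with types over `U` finitely generated over
`SC`: all pairs in `SA` outside of `U` are in `FA ⊆ SC`, and the same for `SB`. Moreover the cut over
`U` of each new meet is either visible in `SC` or has no maximum. -/
structure IsAmalgam (J : Type u) (J' : Type v) [(lang J J').Structure M] [(lang J J').Structure N]
    (U SA SB SC FA FB : Set (N × M)) : Prop where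
  agree_left : ∀ p ∈ SA, ∀ q ∈ SA, Agree J J' p q
  agree_right : ∀ p ∈ SB, ∀ q ∈ SB, Agree J J' p q
  agree_mid : ∀ p ∈ SC, ∀ q ∈ SC, Agree J J' p q
  inf_left : ∀ p ∈ SA, ∀ q ∈ SA, p ⊓ q ∈ SA
  inf_right : ∀ p ∈ SB, ∀ q ∈ SB, p ⊓ q ∈ SB
  inf_mid : ∀ p ∈ SC, ∀ q ∈ SC, p ⊓ q ∈ SC
  base_left : U ⊆ SA
  base_right : U ⊆ SB
  fin_left : FA ⊆ SA
  fin_right : FB ⊆ SB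
  fin_left_mid : FA ⊆ SC
  fin_right_mid : FB ⊆ SC
  reduce_left : ∀ p ∈ SA, p ∈ U ∨ p ∈ FA
  reduce_right : ∀ p ∈ SB, p ∈ U ∨ p ∈ FB
  cut : ∀ p ∈ FA, ∀ q ∈ FB,
    (∃ w ∈ U, w ∈ SC ∧ w.1 ≤ (p ⊓ q).1 ∧ ∀ u ∈ U, u.1 ≤ (p ⊓ q).1 → u.1 ≤ w.1) ∨
    (∀ u ∈ U, u.1 ≤ (p ⊓ q).1 → ∃ u' ∈ U, u.1 < u'.1 ∧ u'.1 ≤ (p ⊓ q).1)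

variable [IsConeTree J J' M] [IsConeTree J J' N] {U SA SB SC FA FB : Set (N × M)}

/-- This is the only comparison not contained in one of the three given types. Being below `p ⊓ q`
means being below both `p` and `q`, which the types of the components decide; equality and being
above need the cut and the meets of `r` with `p` and `q`. -/
theorem IsAmalgam.agree_inf (h : IsAmalgam J J' U SA SB SC FA FB) {p q r : N × M} (hp : p ∈ FA)
    (hq : q ∈ FB) (hr : r ∈ U) : Agree J J' r (p ⊓ q) ∧ Agree J J' (p ⊓ q) r := by
  have hpA := h.fin_left hp
  have hqB := h.fin_right hq
  have hpC := h.fin_left_mid hp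
  have hqC := h.fin_right_mid hq
  have hcC : p ⊓ q ∈ SC := h.inf_mid _ hpC _ hqC
  have hrA := h.base_left hr
  have hrB := h.base_right hr
  have hle : ∀ u ∈ U, (u.1 ≤ (p ⊓ q).1 ↔ u.2 ≤ (p ⊓ q).2) := fun u hu => by
    simp only [Prod.fst_inf, Prod.snd_inf, le_inf_iff]
    exact and_congr (h.agree_left _ (h.base_left hu) _ hpA).le_iff
      (h.agree_right _ (h.base_right hu) _ hqB).le_iff
  have hU : ∀ u ∈ U, ∀ u' ∈ U, Agree J J' u u' := fun u hu u' hu' =>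
    h.agree_left _ (h.base_left hu) _ (h.base_left hu')
  have heq : ∀ u ∈ U, (u.1 = (p ⊓ q).1 ↔ u.2 = (p ⊓ q).2) := by
    intro u hu
    -- If the cut has a maximum `w`, only `w` can equal `p ⊓ q`, and `SC` decides whether it does;
    -- if there is no maximum, no element of `U` equals `p ⊓ q`.
    rcases h.cut p hp q hq with ⟨w, hw, hwC, hwle, hmax⟩ | hmax
    · have h1 := h.agree_mid w hwC _ hcC
      have h2 := h.agree_mid _ hcC w hwC
      constructor
      · intro e
        have hwu : w = u := (hU _ hw _ hu).eq_of_fst_eq (hU _ hu _ hw)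
          (le_antisymm (hwle.trans e.ge) (hmax u hu e.le))
        subst hwu
        exact congrArg Prod.snd (h1.eq_of_fst_eq h2 e)
      · intro e
        have hwu : w = u := (hU _ hw _ hu).eq_of_snd_eq (hU _ hu _ hw)
          (le_antisymm ((h1.le_iff.1 hwle).trans e.ge)
            ((hU _ hu _ hw).le_iff.1 (hmax u hu ((hle u hu).2 e.le))))
        subst hwu
        exact congrArg Prod.fst (h1.eq_of_snd_eq h2 e)
    · constructor
      · intro e
        obtain ⟨u', -, hlt, hle'⟩ := hmax u hu e.le
        exact (hlt.not_ge (hle'.trans e.ge)).elim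
      · intro e
        obtain ⟨u', hu', hlt, hle'⟩ := hmax u hu ((hle u hu).2 e.le)
        exact (hlt.not_ge ((hU _ hu' _ hu).le_iff.2 (((hle u' hu').1 hle').trans e.ge))).elim
  have hge : (p ⊓ q).1 ≤ r.1 ↔ (p ⊓ q).2 ≤ r.2 := by
    have e1 : (p ⊓ q).1 ≤ r.1 ↔ (p ⊓ q).1 ≤ (r ⊓ p).1 := by simp
    have e2 : (p ⊓ q).2 ≤ r.2 ↔ (p ⊓ q).2 ≤ (r ⊓ p).2 := by simp
    have f1 : (p ⊓ q).1 ≤ r.1 ↔ (p ⊓ q).1 ≤ (r ⊓ q).1 := by simp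
    have f2 : (p ⊓ q).2 ≤ r.2 ↔ (p ⊓ q).2 ≤ (r ⊓ q).2 := by simp
    -- If `r ⊓ p` or `r ⊓ q` is outside `U`, it lies in `SC`, where it can be compared with `p ⊓ q`.
    -- Otherwise both are in `U`.
    rcases h.reduce_left _ (h.inf_left _ hrA _ hpA) with he | he
    swap
    · rw [e1, e2]; exact (h.agree_mid _ hcC _ (h.fin_left_mid he)).le_iff
    rcases h.reduce_right _ (h.inf_right _ hrB _ hqB) with hf | hf
    swap
    · rw [f1, f2]; exact (h.agree_mid _ hcC _ (h.fin_right_mid hf)).le_iff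
    -- If the two meets coincide they are below `p ⊓ q`, so `p ⊓ q ≤ r` amounts to an equality with
    -- an element of `U`. If they differ, `p ⊓ q ≤ r` holds in both structures.
    by_cases hef : r ⊓ p = r ⊓ q
    · have hlow : r ⊓ p ≤ p ⊓ q := le_inf inf_le_right (hef ▸ inf_le_right)
      rw [e1, e2]
      have := heq _ he
      constructor
      · intro hl
        exact (this.1 (le_antisymm hlow.1 hl)).ge
      · intro hl
        exact (this.2 (le_antisymm hlow.2 hl)).ge
    · refine iff_of_true (IsConeTree.inf_le_of_inf_ne J J' fun e => hef ?_)
        (IsConeTree.inf_le_of_inf_ne J J' fun e => hef ?_)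
      · exact (hU _ he _ hf).eq_of_fst_eq (hU _ hf _ he) e
      · exact (hU _ he _ hf).eq_of_snd_eq (hU _ hf _ he) e
  have hrp := h.agree_left _ hrA _ hpA
  have hpr := h.agree_left _ hpA _ hrA
  constructor
  · refine ⟨hle r hr, fun j => ?_, hrp.un_iff⟩
    by_cases hcmp : r.1 ≤ (p ⊓ q).1 ∨ (p ⊓ q).1 ≤ r.1
    · have hcmp' : r.2 ≤ (p ⊓ q).2 ∨ (p ⊓ q).2 ≤ r.2 := by rwa [← hle r hr, ← hge]
      exact iff_of_false (fun hR => not_or.2 (IsConeTree.not_le_of_rel hR) hcmp)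
        (fun hR => not_or.2 (IsConeTree.not_le_of_rel hR) hcmp')
    · obtain ⟨c1, c2⟩ := not_or.1 hcmp
      -- Since `r` and `p ⊓ q` are incomparable, `p ⊓ q` can be raised to `p`, which moves the
      -- question into `SA`.
      rw [IsConeTree.rel_iff_of_le_right j c1 c2 (inf_le_left : p ⊓ q ≤ p).1,
        IsConeTree.rel_iff_of_le_right j (mt (hle r hr).2 c1) (mt hge.2 c2)
          (inf_le_left : p ⊓ q ≤ p).2]
      exact hrp.rel_iff j
  · refine ⟨hge, fun j => ?_, (h.agree_mid _ hcC _ hcC).un_iff⟩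
    by_cases hcmp : (p ⊓ q).1 ≤ r.1 ∨ r.1 ≤ (p ⊓ q).1
    · have hcmp' : (p ⊓ q).2 ≤ r.2 ∨ r.2 ≤ (p ⊓ q).2 := by rwa [← hle r hr, ← hge]
      exact iff_of_false (fun hR => not_or.2 (IsConeTree.not_le_of_rel hR) hcmp)
        (fun hR => not_or.2 (IsConeTree.not_le_of_rel hR) hcmp')
    · obtain ⟨c2, c1⟩ := not_or.1 hcmp
      rw [IsConeTree.rel_iff_of_le_left j c2 c1 (inf_le_left : p ⊓ q ≤ p).1,
        IsConeTree.rel_iff_of_le_left j (mt hge.2 c2) (mt (hle r hr).2 c1)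
          (inf_le_left : p ⊓ q ≤ p).2]
      exact hpr.rel_iff j

/-- The subsemilattice generated by two subsemilattices. -/
def joinSet (SA SB : Set (N × M)) : Set (N × M) :=
  {p | p ∈ SA ∨ p ∈ SB ∨ ∃ a ∈ SA, ∃ b ∈ SB, p = a ⊓ b}

/-- If one factor of a mixed meet is in `U`, the other side absorbs it. So everything is in `U` or
in `SC`, and only pairs with one member of each need `IsAmalgam.agree_inf`. -/
theorem IsAmalgam.agree_joinSet (h : IsAmalgam J J' U SA SB SC FA FB) {p q : N × M}
    (hp : p ∈ joinSet SA SB) (hq : q ∈ joinSet SA SB) : Agree J J' p q := by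
  have normal : ∀ p ∈ joinSet SA SB, p ∈ U ∨ p ∈ FA ∨ p ∈ FB ∨ ∃ a ∈ FA, ∃ b ∈ FB, p = a ⊓ b := by
    have hB : ∀ p ∈ SB, p ∈ U ∨ p ∈ FA ∨ p ∈ FB ∨ ∃ a ∈ FA, ∃ b ∈ FB, p = a ⊓ b :=
      fun p hp => (h.reduce_right p hp).imp_right fun h => Or.inr (Or.inl h)
    have hA : ∀ p ∈ SA, p ∈ U ∨ p ∈ FA ∨ p ∈ FB ∨ ∃ a ∈ FA, ∃ b ∈ FB, p = a ⊓ b :=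
      fun p hp => (h.reduce_left p hp).imp_right Or.inl
    rintro p (hp | hp | ⟨a, ha, b, hb, rfl⟩)
    · exact hA p hp
    · exact hB p hp
    · rcases h.reduce_left a ha with ha' | ha'
      · exact hB _ (h.inf_right _ (h.base_right ha') _ hb)
      rcases h.reduce_right b hb with hb' | hb'
      · exact hA _ (h.inf_left _ ha _ (h.base_left hb'))
      · exact Or.inr (Or.inr (Or.inr ⟨a, ha', b, hb', rfl⟩))
  have mid : ∀ p, (p ∈ FA ∨ p ∈ FB ∨ ∃ a ∈ FA, ∃ b ∈ FB, p = a ⊓ b) →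
      p ∈ SC ∧ ∀ u ∈ U, Agree J J' u p ∧ Agree J J' p u := by
    rintro p (hp | hp | ⟨a, ha, b, hb, rfl⟩)
    · exact ⟨h.fin_left_mid hp, fun u hu => ⟨h.agree_left _ (h.base_left hu) _ (h.fin_left hp),
        h.agree_left _ (h.fin_left hp) _ (h.base_left hu)⟩⟩
    · exact ⟨h.fin_right_mid hp, fun u hu => ⟨h.agree_right _ (h.base_right hu) _ (h.fin_right hp),
        h.agree_right _ (h.fin_right hp) _ (h.base_right hu)⟩⟩
    · exact ⟨h.inf_mid _ (h.fin_left_mid ha) _ (h.fin_right_mid hb),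
        fun u hu => h.agree_inf ha hb hu⟩
  rcases normal p hp with hp | hp <;> rcases normal q hq with hq | hq
  · exact h.agree_left _ (h.base_left hp) _ (h.base_left hq)
  · exact ((mid q hq).2 p hp).1
  · exact ((mid p hp).2 q hq).2
  · exact h.agree_mid _ (mid p hp).1 _ (mid q hq).1

omit [(lang J J').Structure M] [(lang J J').Structure N] in
theorem joinSet_inf (hA : ∀ p ∈ SA, ∀ q ∈ SA, p ⊓ q ∈ SA) (hB : ∀ p ∈ SB, ∀ q ∈ SB, p ⊓ q ∈ SB)
    {p q : N × M} (hp : p ∈ joinSet SA SB) (hq : q ∈ joinSet SA SB) : p ⊓ q ∈ joinSet SA SB := by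
  rcases hp with hp | hp | ⟨a, ha, b, hb, rfl⟩ <;> rcases hq with hq | hq | ⟨c, hc, d, hd, rfl⟩
  · exact Or.inl (hA _ hp _ hq)
  · exact Or.inr (Or.inr ⟨p, hp, q, hq, rfl⟩)
  · exact Or.inr (Or.inr ⟨p ⊓ c, hA _ hp _ hc, d, hd, (inf_assoc _ _ _).symm⟩)
  · exact Or.inr (Or.inr ⟨q, hq, p, hp, inf_comm _ _⟩)
  · exact Or.inr (Or.inl (hB _ hp _ hq))
  · exact Or.inr (Or.inr ⟨c, hc, p ⊓ d, hB _ hp _ hd, inf_left_comm _ _ _⟩)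
  · exact Or.inr (Or.inr ⟨a ⊓ q, hA _ ha _ hq, b, hb, inf_right_comm _ _ _⟩)
  · exact Or.inr (Or.inr ⟨a, ha, b ⊓ q, hB _ hb _ hq, inf_assoc _ _ _⟩)
  · exact Or.inr (Or.inr ⟨a ⊓ c, hA _ ha _ hc, b ⊓ d, hB _ hb _ hd, inf_inf_inf_comm _ _ _ _⟩)

end Amalgam

/-! ### Types and atomic formulas in a general language -/

section General

variable {L : FirstOrder.Language.{u, v}}

/-- In models of `T`, the type of a finite tuple is determined by its atomic formulas. -/
def AtomicTypesDecide (T : L.Theory) : Prop :=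
  ∀ (N M : Type w) [L.Structure N] [L.Structure M], Nonempty N → Nonempty M → N ⊨ T → M ⊨ T →
    ∀ (k : ℕ) (f : Fin k → N) (g : Fin k → M),
      (∀ φ : L.Formula (Fin k), BoundedFormula.IsAtomic φ → (φ.Realize f ↔ φ.Realize g)) →
      ∀ φ : L.Formula (Fin k), φ.Realize f ↔ φ.Realize g

theorem EliminatesQuantifiers.atomicTypesDecide {T : L.Theory} (h : EliminatesQuantifiers T) :
    AtomicTypesDecide.{u, v, w} T := by
  intro N M _ _ _ _ _ _ k f g hat φ
  obtain ⟨ψ, hψ, hφψ⟩ := h k φ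
  rw [hφψ.realize_iff, hφψ.realize_iff]
  -- The number of bound variables is made a variable so that induction on quantifier-free formulas
  -- applies.
  suffices ∀ n (ψ : L.BoundedFormula (Fin k) n), ψ.IsQF → n = 0 →
      ∀ (xs : Fin n → N) (ys : Fin n → M), ψ.Realize f xs ↔ ψ.Realize g ys from
    this 0 ψ hψ rfl default default
  intro n ψ hψ hn xs ys
  subst hn
  obtain rfl : xs = default := Subsingleton.elim _ _
  obtain rfl : ys = default := Subsingleton.elim _ _
  induction hψ with
  | falsum => exact Iff.rfl
  | of_isAtomic h => exact hat _ h
  | imp _ _ h1 h2 => exact imp_congr h1 h2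

theorem exists_fin_formula {α : Type*} (φ : L.Formula α) :
    ∃ (k : ℕ) (e : Fin k → α) (ψ : L.Formula (Fin k)),
      ∀ (M : Type x) [L.Structure M] (f : α → M), φ.Realize f ↔ ψ.Realize (f ∘ e) := by
  classical
  let eqv := Fintype.equivFin φ.freeVarFinset
  refine ⟨_, fun i => (eqv.symm i : α), φ.restrictFreeVar eqv, fun M _ f => ?_⟩
  exact (BoundedFormula.realize_restrictFreeVar f fun a => by simp).symm

/-- A formula mentions only finitely many variables, so finite tuples suffice. -/
theorem AtomicTypesDecide.realize_iff {T : L.Theory} (h : AtomicTypesDecide.{u, v, w} T)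
    {N M : Type w} [L.Structure N] [L.Structure M] [Nonempty N] [Nonempty M] (hN : N ⊨ T)
    (hM : M ⊨ T) {α : Type*} (f : α → N) (g : α → M)
    (hat : ∀ φ : L.Formula α, BoundedFormula.IsAtomic φ → (φ.Realize f ↔ φ.Realize g))
    (φ : L.Formula α) : φ.Realize f ↔ φ.Realize g := by
  obtain ⟨k, e, ψ, hψ⟩ := exists_fin_formula φ
  rw [hψ N f, hψ M g]
  refine h N M ‹_› ‹_› hN hM k _ _ (fun χ hχ => ?_) ψ
  rw [← Formula.realize_relabel, ← Formula.realize_relabel]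
  exact hat _ (BoundedFormula.IsAtomic.relabel hχ _)

variable {U : Type w} [L.Structure U] {N : Type (max u v w)} [L.Structure N]

/-- Complete types contain each formula or its negation, so satisfying the type gives equivalence
and not just one implication. -/
theorem realize_iff_of_entailed {M : Type*} [L.Structure M] {α β : Type} {ι : U ↪ₑ[L] N}
    {A : Set U} {a : α → N} {s : U ⊕ β → M} {r : α → β}
    (h : ∀ φ ∈ tp ι A a, (φ.relabel (Sum.map id r) : L.Formula (U ⊕ β)).Realize s)
    (φ : L.Formula (A ⊕ α)) :
    φ.Realize (Sum.elim (fun c : A => ι c) a) ↔ φ.Realize (s ∘ Sum.map Subtype.val r) := by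
  have key : ∀ φ : L.Formula (A ⊕ α), φ.Realize (Sum.elim (fun c : A => ι c) a) →
      φ.Realize (s ∘ Sum.map Subtype.val r) := by
    intro φ hφ
    have := h _ ⟨φ, hφ, rfl⟩
    rw [Formula.realize_relabel, Formula.realize_relabel] at this
    convert this using 1
    funext x
    cases x <;> rfl
  refine ⟨key φ, fun hφ => ?_⟩
  by_contra hn
  exact key φ.not (Formula.realize_not.2 hn) hφ

theorem realize_iff_of_entailed_univ {M : Type*} [L.Structure M] {α β : Type} {ι : U ↪ₑ[L] N}
    {a : α → N} {s : U ⊕ β → M} {r : α → β}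
    (h : ∀ φ ∈ tp ι Set.univ a, (φ.relabel (Sum.map id r) : L.Formula (U ⊕ β)).Realize s)
    (φ : L.Formula (U ⊕ α)) :
    φ.Realize (Sum.elim ι a) ↔ φ.Realize (s ∘ Sum.map id r) := by
  have := realize_iff_of_entailed h
    (φ.relabel (Sum.map (fun c => ⟨c, trivial⟩) id : U ⊕ α → (Set.univ : Set U) ⊕ α))
  rw [Formula.realize_relabel, Formula.realize_relabel] at this
  convert this using 2
  · funext x; cases x <;> rfl
  · funext x; cases x <;> rfl

end General

/-! ### Weak binarity when atomic formulas determine types -/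

/-- The elements that generate, over `U`, the subsemilattice generated by `U` and `e`. -/
def generators {U : Type u} {N : Type v} {M : Type w} [SemilatticeInf N] [SemilatticeInf M] {k : ℕ}
    (ι : U → N) (e : Fin k → N) (g : U ⊕ Fin k → M) (c : Fin k → U)
    (p : Fin k × Option (Fin k)) : N × M :=
  (e p.1, g (Sum.inr p.1)) ⊓
    p.2.elim (ι (c p.1), g (Sum.inl (c p.1))) (fun j => (e j, g (Sum.inr j)))

section Main

variable {J : Type u} {J' : Type v} {U : Type w} [(lang J J').Structure U]
variable {N : Type (max u v w)} [SemilatticeInf N] [(lang J J').Structure N] [IsConeTree J J' N]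

theorem elementaryEmbedding_inf (ι : U ↪ₑ[lang J J'] N) (c d : U) :
    ι c ⊓ ι d = ι (Structure.funMap (meetSymb : (lang J J').Functions 2) ![c, d]) := by
  rw [ι.map_fun, ← IsConeTree.funMap_meet (J := J) (J' := J')]
  congr 1
  funext i
  fin_cases i <;> rfl

/-- At most one of the meets of a given element with elements of `U` is outside of `U`. -/
theorem exists_inf_eq_of_notMem_range [Nonempty U] (ι : U ↪ₑ[lang J J'] N) (a : N) :
    ∃ c : U, ∀ d : U, ι d ⊓ a ∉ Set.range ι → ι d ⊓ a = ι c ⊓ a := by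
  by_cases h : ∃ c : U, ι c ⊓ a ∉ Set.range ι
  swap
  · exact ⟨Classical.arbitrary U, fun d hd => (h ⟨d, hd⟩).elim⟩
  obtain ⟨c, hc⟩ := h
  refine ⟨c, fun d hd => ?_⟩
  have hcd := elementaryEmbedding_inf ι c d
  -- Otherwise `ι c ⊓ ι d` is below `ι c ⊓ a`, and comparing the two meets with `a` forces `ι d ⊓ a
  -- = ι c ⊓ ι d`, an element of `U`. Once both meets with `a` are below `ι c ⊓ ι d`, they are
  -- equal.
  have hc' : ¬ι c ⊓ a ≤ ι c ⊓ ι d → ι d ⊓ a ∈ Set.range ι := by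
    intro h
    by_contra hd
    have hle : ι c ⊓ ι d ≤ ι c ⊓ a :=
      (IsConeTree.comparable J J' inf_le_left inf_le_left).resolve_left h
    have h2 : ι c ⊓ ι d ≤ ι d ⊓ a := le_inf inf_le_right (hle.trans inf_le_right)
    rcases IsConeTree.comparable J J' (inf_le_right : ι c ⊓ a ≤ a) (inf_le_right : ι d ⊓ a ≤ a)
      with h3 | h3
    · exact h (le_inf inf_le_left (h3.trans inf_le_left))
    · refine hd ⟨_, hcd.symm.trans (le_antisymm h2 (le_inf (h3.trans inf_le_left) inf_le_left))⟩
  have h1 : ι c ⊓ a ≤ ι c ⊓ ι d := by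
    by_contra h
    exact hd (hc' h)
  have h2 : ι d ⊓ a ≤ ι c ⊓ ι d := by
    rcases IsConeTree.comparable J J' (inf_le_left : ι d ⊓ a ≤ ι d) (inf_le_right : ι c ⊓ ι d ≤ ι d)
      with h | h
    · exact h
    · have h3 : ι c ⊓ ι d ≤ ι c ⊓ a := le_inf inf_le_left (h.trans inf_le_right)
      exact (hc ⟨_, hcd.symm.trans (le_antisymm h3 h1)⟩).elim
  exact le_antisymm (le_inf (h2.trans inf_le_left) inf_le_right)
    (le_inf (h1.trans inf_le_right) inf_le_right)

variable {M : Type x} [SemilatticeInf M] [(lang J J').Structure M] [IsConeTree J J' M] {k : ℕ}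

/-- A term is a meet of two variables in `N`, and by the choice of `c` a mixed meet outside `U` may
be taken with `c i`. An identity in `N` transfers to `M`, so the pairs of values have the same form.
-/
theorem pairVal_mem_base_or_generators (ι : U ↪ₑ[lang J J'] N) {e : Fin k → N}
    {g : U ⊕ Fin k → M} {c : Fin k → U}
    (hc : ∀ i d, ι d ⊓ e i ∉ Set.range ι → ι d ⊓ e i = ι (c i) ⊓ e i)
    (h : ∀ φ : (lang J J').Formula (U ⊕ Fin k), φ.Realize (Sum.elim ι e) ↔ φ.Realize g)
    (t : (lang J J').Term (U ⊕ Fin k)) :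
    pairVal (Sum.elim ι e) g t ∈ Set.range (fun d => (ι d, g (Sum.inl d))) ∨
      pairVal (Sum.elim ι e) g t ∈ Set.range (generators ι e g c) := by
  have key : ∀ s t : (lang J J').Term (U ⊕ Fin k), s.realize (Sum.elim ι e) =
      t.realize (Sum.elim ι e) → pairVal (Sum.elim ι e) g s = pairVal (Sum.elim ι e) g t :=
    fun s t hst => (agree_pairVal (fun φ _ => h φ) s t).eq_of_fst_eq
      (agree_pairVal (fun φ _ => h φ) t s) hst
  have base : t.realize (Sum.elim ι e) ∈ Set.range ι →
      pairVal (Sum.elim ι e) g t ∈ Set.range (fun d => (ι d, g (Sum.inl d))) := by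
    rintro ⟨d, hd⟩
    exact ⟨d, (key t (Term.var (Sum.inl d)) hd.symm).symm⟩
  by_cases hb : t.realize (Sum.elim ι e) ∈ Set.range ι
  · exact Or.inl (base hb)
  right
  have mixed : ∀ d i, t.realize (Sum.elim ι e) = ι d ⊓ e i →
      pairVal (Sum.elim ι e) g t ∈ Set.range (generators ι e g c) := by
    intro d i hd
    refine ⟨(i, none), ?_⟩
    rw [key t (meetT (Term.var (Sum.inr i)) (Term.var (Sum.inl (c i)))), pairVal_meetT]
    · rfl
    · rw [hd, hc i d (hd ▸ hb), inf_comm]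
      simp
  obtain ⟨x, y, hxy⟩ := exists_realize_eq_inf (Sum.elim ι e) t
  rcases x with d | i <;> rcases y with d' | j
  · exact (hb ⟨_, (hxy.trans (elementaryEmbedding_inf ι d d')).symm⟩).elim
  · exact mixed _ _ hxy
  · exact mixed _ _ (hxy.trans (inf_comm _ _))
  · refine ⟨(i, some j), ?_⟩
    rw [key t (meetT (Term.var (Sum.inr i)) (Term.var (Sum.inr j))) (by simpa using hxy),
      pairVal_meetT]
    rfl

/-- If atomic types decide types, and all models are meet-trees with the `R j` on open cones, then
types of pairs over a monster model are determined by the types of their components together with the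
type of the pair over a finite set. -/
theorem isWeaklyBinaryForAllTuples_of_atomicTypesDecide {J : Type u} {J' : Type v}
    {T : (lang J J').Theory} (hT : AtomicTypesDecide.{0, max u v, max u v w} T)
    (htree : ∀ (M : Type (max u v w)) [(lang J J').Structure M], Nonempty M → M ⊨ T →
      ∃ _ : SemilatticeInf M, IsConeTree J J' M) :
    IsWeaklyBinaryForAllTuples.{0, max u v, w} T := by
  intro κ U _ hU N _ ι m n a b
  have := hU.nonempty
  have hN : N ⊨ T := (ι.theory_model_iff T).1 hU.models
  have : Nonempty N := hU.nonempty.map ι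
  obtain ⟨_, _⟩ := htree N ‹_› hN
  choose ca hca using fun i => exists_inf_eq_of_notMem_range ι (a i)
  choose cb hcb using fun i => exists_inf_eq_of_notMem_range ι (b i)
  let xa : Fin m × Option (Fin m) → N := fun p => a p.1 ⊓ p.2.elim (ι (ca p.1)) a
  let xb : Fin n × Option (Fin n) → N := fun p => b p.1 ⊓ p.2.elim (ι (cb p.1)) b
  -- `w p q` is the largest element of `U` below `xa p ⊓ xb q` if there is one, and arbitrary
  -- otherwise.
  have hw : ∀ p q, ∃ w : U, (∃ w' : U, ι w' ≤ xa p ⊓ xb q ∧ ∀ d, ι d ≤ xa p ⊓ xb q → ι d ≤ ι w') →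
      ι w ≤ xa p ⊓ xb q ∧ ∀ d, ι d ≤ xa p ⊓ xb q → ι d ≤ ι w := by
    intro p q
    by_cases h : ∃ w' : U, ι w' ≤ xa p ⊓ xb q ∧ ∀ d, ι d ≤ xa p ⊓ xb q → ι d ≤ ι w'
    · exact h.imp fun w hw _ => hw
    · exact ⟨Classical.arbitrary U, fun h' => (h h').elim⟩
  choose w hw using hw
  let A : Set U := Set.range ca ∪ Set.range cb ∪ Set.range (Function.uncurry w)
  have hA : A.Finite := ((Set.finite_range _).union (Set.finite_range _)).union (Set.finite_range _)
  have haA : ∀ i, ca i ∈ A := fun i => Or.inl (Or.inl ⟨i, rfl⟩)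
  have hbA : ∀ i, cb i ∈ A := fun i => Or.inl (Or.inr ⟨i, rfl⟩)
  have hwA : ∀ p q, w p q ∈ A := fun p q => Or.inr ⟨(p, q), rfl⟩
  refine ⟨A, hA.lt_aleph0.trans hU.aleph0_lt, ?_⟩
  intro M _ _ s hs
  have hsa := realize_iff_of_entailed_univ (ι := ι) (a := a) (s := s) (r := Sum.inl)
    fun φ hφ => hs _ (Or.inl (Or.inl ⟨φ, hφ, rfl⟩))
  have hsb := realize_iff_of_entailed_univ (ι := ι) (a := b) (s := s) (r := Sum.inr)
    fun φ hφ => hs _ (Or.inl (Or.inr ⟨φ, hφ, rfl⟩))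
  have hsc := realize_iff_of_entailed (ι := ι) (A := A) (a := Sum.elim a b) (s := s) (r := id)
    fun φ hφ => by
      have := hs φ (Or.inr hφ)
      rwa [Formula.realize_relabel, Sum.map_id_id, Function.comp_id]
  -- Sentences of `T` belong to `tp(a/U)`, so the structure realising the three types is a model.
  have hM : M ⊨ T := by
    refine Theory.model_iff _ |>.2 fun φ hφ => ?_
    have h1 := hsa (φ.relabel Empty.elim)
    rw [Formula.realize_relabel, Formula.realize_relabel, Subsingleton.elim (_ ∘ Empty.elim) default,
      Subsingleton.elim ((s ∘ _) ∘ Empty.elim) default] at h1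
    exact h1.1 (Theory.realize_sentence_of_mem T hφ)
  obtain ⟨_, _⟩ := htree M ‹_› hM
  let f : U ⊕ (Fin m ⊕ Fin n) → N := Sum.elim ι (Sum.elim a b)
  let base : Set (N × M) := Set.range fun d : U => (ι d, s (Sum.inl d))
  let SA : Set (N × M) := Set.range
    (pairVal (J := J) (J' := J') (Sum.elim ι a) (s ∘ Sum.map id Sum.inl))
  let SB : Set (N × M) := Set.range
    (pairVal (J := J) (J' := J') (Sum.elim ι b) (s ∘ Sum.map id Sum.inr))
  let SC : Set (N × M) := Set.range
    (pairVal (J := J) (J' := J') (Sum.elim (fun c : A => ι c) (Sum.elim a b))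
      (s ∘ Sum.map Subtype.val id))
  let FA : Set (N × M) := Set.range (generators ι a (s ∘ Sum.map id Sum.inl) ca)
  let FB : Set (N × M) := Set.range (generators ι b (s ∘ Sum.map id Sum.inr) cb)
  have inf_range : ∀ {α : Type w} (f : α → N) (g : α → M),
      ∀ p ∈ Set.range (pairVal (J := J) (J' := J') f g),
      ∀ q ∈ Set.range (pairVal (J := J) (J' := J') f g),
        p ⊓ q ∈ Set.range (pairVal (J := J) (J' := J') f g) := by
    rintro α f g _ ⟨t, rfl⟩ _ ⟨t', rfl⟩
    exact ⟨meetT t t', pairVal_meetT _ _ _ _⟩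
  have hbaseA : base ⊆ SA := by
    rintro _ ⟨d, rfl⟩
    exact ⟨Term.var (Sum.inl d), rfl⟩
  have hbaseB : base ⊆ SB := by
    rintro _ ⟨d, rfl⟩
    exact ⟨Term.var (Sum.inl d), rfl⟩
  have hbaseC : ∀ d ∈ A, (ι d, s (Sum.inl d)) ∈ SC := fun d hd => ⟨Term.var (Sum.inl ⟨d, hd⟩), rfl⟩
  have amalgam : IsAmalgam J J' base SA SB SC FA FB :=
    { agree_left := by
        rintro _ ⟨t, rfl⟩ _ ⟨t', rfl⟩
        exact agree_pairVal (fun φ _ => hsa φ) t t'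
      agree_right := by
        rintro _ ⟨t, rfl⟩ _ ⟨t', rfl⟩
        exact agree_pairVal (fun φ _ => hsb φ) t t'
      agree_mid := by
        rintro _ ⟨t, rfl⟩ _ ⟨t', rfl⟩
        exact agree_pairVal (fun φ _ => hsc φ) t t'
      inf_left := inf_range _ _
      inf_right := inf_range _ _
      inf_mid := inf_range _ _
      base_left := hbaseA
      base_right := hbaseB
      fin_left := by
        rintro _ ⟨⟨i, _ | j⟩, rfl⟩
        · exact inf_range _ _ _ ⟨Term.var (Sum.inr i), rfl⟩ _ ⟨Term.var (Sum.inl (ca i)), rfl⟩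
        · exact inf_range _ _ _ ⟨Term.var (Sum.inr i), rfl⟩ _ ⟨Term.var (Sum.inr j), rfl⟩
      fin_right := by
        rintro _ ⟨⟨i, _ | j⟩, rfl⟩
        · exact inf_range _ _ _ ⟨Term.var (Sum.inr i), rfl⟩ _ ⟨Term.var (Sum.inl (cb i)), rfl⟩
        · exact inf_range _ _ _ ⟨Term.var (Sum.inr i), rfl⟩ _ ⟨Term.var (Sum.inr j), rfl⟩
      fin_left_mid := by
        rintro _ ⟨⟨i, _ | j⟩, rfl⟩
        · exact inf_range _ _ _ ⟨Term.var (Sum.inr (Sum.inl i)), rfl⟩ _ (hbaseC _ (haA i))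
        · exact inf_range _ _ _ ⟨Term.var (Sum.inr (Sum.inl i)), rfl⟩ _
            ⟨Term.var (Sum.inr (Sum.inl j)), rfl⟩
      fin_right_mid := by
        rintro _ ⟨⟨i, _ | j⟩, rfl⟩
        · exact inf_range _ _ _ ⟨Term.var (Sum.inr (Sum.inr i)), rfl⟩ _ (hbaseC _ (hbA i))
        · exact inf_range _ _ _ ⟨Term.var (Sum.inr (Sum.inr i)), rfl⟩ _
            ⟨Term.var (Sum.inr (Sum.inr j)), rfl⟩
      reduce_left := by
        rintro _ ⟨t, rfl⟩
        exact pairVal_mem_base_or_generators ι hca hsa t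
      reduce_right := by
        rintro _ ⟨t, rfl⟩
        exact pairVal_mem_base_or_generators ι hcb hsb t
      cut := by
        rintro _ ⟨p, rfl⟩ _ ⟨q, rfl⟩
        have hp : (generators ι a (s ∘ Sum.map id Sum.inl) ca p).1 = xa p := by
          rcases p with ⟨i, _ | j⟩ <;> rfl
        have hq : (generators ι b (s ∘ Sum.map id Sum.inr) cb q).1 = xb q := by
          rcases q with ⟨i, _ | j⟩ <;> rfl
        rw [Prod.fst_inf, hp, hq]
        by_cases h : ∃ w' : U, ι w' ≤ xa p ⊓ xb q ∧ ∀ d, ι d ≤ xa p ⊓ xb q → ι d ≤ ι w'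
        · refine Or.inl ⟨_, ⟨w p q, rfl⟩, hbaseC _ (hwA p q), (hw p q h).1, ?_⟩
          rintro _ ⟨d, rfl⟩ hd
          exact (hw p q h).2 d hd
        · right
          rintro _ ⟨d, rfl⟩ hd
          push Not at h
          obtain ⟨d', hd', hlt⟩ := h d hd
          refine ⟨_, ⟨d', rfl⟩, lt_of_le_not_ge ?_ hlt, hd'⟩
          exact (IsConeTree.comparable J J' hd hd').resolve_right hlt }
  have hall : ∀ t : (lang J J').Term (U ⊕ (Fin m ⊕ Fin n)), pairVal f s t ∈ joinSet SA SB := by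
    intro t
    induction t using Term.meet_induction with
    | var x =>
      rcases x with d | i | i
      · exact Or.inl (hbaseA ⟨d, rfl⟩)
      · exact Or.inl ⟨Term.var (Sum.inr i), rfl⟩
      · exact Or.inr (Or.inl ⟨Term.var (Sum.inr i), rfl⟩)
    | meet t t' h h' =>
      rw [pairVal_meetT]
      exact joinSet_inf (inf_range _ _) (inf_range _ _) h h'
  have agree : ∀ φ : (lang J J').Formula (U ⊕ (Fin m ⊕ Fin n)), φ.Realize f ↔ φ.Realize s := by
    refine hT.realize_iff hN hM f s fun φ hφ => ?_
    refine realize_atomic_iff_of_agree (fun t t' => ?_) hφ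
    have hr : ∀ t : (lang J J').Term ((U ⊕ (Fin m ⊕ Fin n)) ⊕ Fin 0),
        pairVal (Sum.elim f default) (Sum.elim s default) t =
          pairVal f s (t.relabel (Sum.elim id Fin.elim0)) := by
      intro t
      unfold pairVal
      rw [Term.realize_relabel, Term.realize_relabel]
      congr 2 <;> (funext x; rcases x with x | x <;> [rfl; exact x.elim0])
    rw [hr, hr]
    exact amalgam.agree_joinSet (hall _) (hall _)
  rintro _ ⟨φ, hφ, rfl⟩
  rw [← agree, Formula.realize_relabel]
  convert hφ using 1
  funext x
  rcases x with x | x <;> rfl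

theorem IsWeaklyBinaryForAllTuples.isWeaklyBinary {L : FirstOrder.Language.{u, v}} {T : L.Theory}
    (h : IsWeaklyBinaryForAllTuples.{u, v, w} T) : IsWeaklyBinary.{u, v, w} T :=
  fun κ U _ hU N _ ι m n a b _ _ => h κ U hU N ι m n a b

theorem IsBinaryConeExpansion.isWeaklyBinaryForAllTuples {J : Type u} {J' : Type v}
    {T : (lang J J').Theory} (h : IsBinaryConeExpansion T) :
    IsWeaklyBinaryForAllTuples.{0, max u v, w} T := by
  refine isWeaklyBinaryForAllTuples_of_atomicTypesDecide h.eliminatesQuantifiers.atomicTypesDecide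
    fun M _ _ _ => exists_isConeTree ?_ ?_
  · exact (Theory.model_iff _).2 fun φ hφ =>
      (h.models_dmt φ (Or.inl (Or.inl hφ))).realize_sentence M
  · exact (Theory.model_iff _).2 fun φ hφ => (h.onOpenCones φ hφ).realize_sentence M

end Main

/-! ### Back and forth -/

section BackAndForth

variable {J : Type u} {J' : Type v} {M : Type w} {N : Type x}
variable [SemilatticeInf M] [(lang J J').Structure M] [SemilatticeInf N] [(lang J J').Structure N]

/-- The graph of an isomorphism between finite substructures of `N` and `M`. -/
structure IsPartialIso (J : Type u) (J' : Type v) [(lang J J').Structure M]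
    [(lang J J').Structure N] (S : Set (N × M)) : Prop where
  finite : S.Finite
  inf_mem : ∀ p ∈ S, ∀ q ∈ S, p ⊓ q ∈ S
  agree : ∀ p ∈ S, ∀ q ∈ S, Agree J J' p q

theorem Agree.swap {p q : N × M} (h : Agree J J' p q) : Agree J J' p.swap q.swap :=
  ⟨h.le_iff.symm, fun j => (h.rel_iff j).symm, fun j => (h.un_iff j).symm⟩

theorem IsPartialIso.swap {S : Set (N × M)} (h : IsPartialIso J J' S) :
    IsPartialIso J J' (Prod.swap '' S) := by
  refine ⟨h.finite.image _, ?_, ?_⟩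
  · rintro _ ⟨p, hp, rfl⟩ _ ⟨q, hq, rfl⟩
    exact ⟨p ⊓ q, h.inf_mem p hp q hq, rfl⟩
  · rintro _ ⟨p, hp, rfl⟩ _ ⟨q, hq, rfl⟩
    exact (h.agree p hp q hq).swap

theorem Agree.lt_iff {p q : N × M} (h : Agree J J' p q) (h' : Agree J J' q p) :
    p.1 < q.1 ↔ p.2 < q.2 := by
  rw [lt_iff_le_not_ge, lt_iff_le_not_ge, h.le_iff, h'.le_iff]

/-- Every one-point extension by a new open cone above an element of a finite substructure of `N` can
be copied to `M`. -/
def ExtendsCones (J : Type u) (J' : Type v) (N : Type x) (M : Type w) [SemilatticeInf M]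
    [(lang J J').Structure M] [SemilatticeInf N] [(lang J J').Structure N] : Prop :=
  ∀ S : Set (N × M), IsPartialIso J J' S → ∀ p ∈ S, ∀ c, p.1 < c → (∀ q ∈ S, ¬p.1 < c ⊓ q.1) →
    ∃ d, p.2 < d ∧ (∀ q ∈ S, ¬p.2 < d ⊓ q.2) ∧ ∀ q ∈ S, p.1 < q.1 → ∀ j : J,
      (relOn J' j c q.1 ↔ relOn J' j d q.2) ∧ (relOn J' j q.1 c ↔ relOn J' j q.2 d)

variable (J J') in
theorem IsConeTree.inf_eq_of_not_lt [IsConeTree J J' M] {a b c : M} (h : a ≤ c) (h' : ¬a < c ⊓ b) : c ⊓ b = a ⊓ b := by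
  refine le_antisymm (le_inf ?_ inf_le_right) (inf_le_inf_right b h)
  rcases IsConeTree.comparable J J' h (inf_le_left : c ⊓ b ≤ c) with h1 | h1
  · exact (eq_of_le_of_not_lt h1 h').ge
  · exact h1

variable (J J') in
theorem IsConeTree.inf_eq_of_not_le [IsConeTree J J' M] {a b c : M} (h : c ≤ a) (h' : ¬c ≤ b) : c ⊓ b = a ⊓ b := by
  refine le_antisymm (inf_le_inf_right b h) (le_inf ?_ inf_le_right)
  rcases IsConeTree.comparable J J' h (inf_le_left : a ⊓ b ≤ a) with h1 | h1
  · exact (h' (h1.trans inf_le_right)).elim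
  · exact h1

variable [IsConeTree J J' M] [IsConeTree J J' N] {S : Set (N × M)}

theorem not_relOn_of_le {j : J} {a b : M} (h : a ≤ b ∨ b ≤ a) : ¬relOn J' j a b := fun hR =>
  not_or.2 (IsConeTree.not_le_of_rel hR) h

variable [IsEmpty J']

theorem agree_self (p : N × M) : Agree J J' p p :=
  ⟨iff_of_true le_rfl le_rfl, fun _ => iff_of_false (not_relOn_of_le (Or.inl le_rfl))
    (not_relOn_of_le (Or.inl le_rfl)), fun j => isEmptyElim j⟩

theorem agree_of_incomparable {p q : N × M} (h1 : p.1 ≤ q.1 ↔ p.2 ≤ q.2)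
    (h2 : q.1 ≤ p.1 ↔ q.2 ≤ p.2)
    (hR : ∀ j : J, ¬p.1 ≤ q.1 → ¬q.1 ≤ p.1 → ¬p.2 ≤ q.2 → ¬q.2 ≤ p.2 →
      (relOn J' j p.1 q.1 ↔ relOn J' j p.2 q.2) ∧ (relOn J' j q.1 p.1 ↔ relOn J' j q.2 p.2)) :
    Agree J J' p q ∧ Agree J J' q p := by
  by_cases h : p.1 ≤ q.1 ∨ q.1 ≤ p.1
  · have h' : p.2 ≤ q.2 ∨ q.2 ≤ p.2 := by rwa [← h1, ← h2]
    exact ⟨⟨h1, fun j => iff_of_false (not_relOn_of_le h) (not_relOn_of_le h'),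
      fun j => isEmptyElim j⟩, ⟨h2, fun j => iff_of_false (not_relOn_of_le h.symm)
        (not_relOn_of_le h'.symm), fun j => isEmptyElim j⟩⟩
  · obtain ⟨h3, h4⟩ := not_or.1 h
    have hR' := fun j => hR j h3 h4 (mt h1.2 h3) (mt h2.2 h4)
    exact ⟨⟨h1, fun j => (hR' j).1, fun j => isEmptyElim j⟩,
      ⟨h2, fun j => (hR' j).2, fun j => isEmptyElim j⟩⟩

theorem IsPartialIso.insert (h : IsPartialIso J J' S) {p : N × M}
    (hinf : ∀ q ∈ S, p ⊓ q ∈ insert p S)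
    (hag : ∀ q ∈ S, Agree J J' p q ∧ Agree J J' q p) : IsPartialIso J J' (insert p S) := by
  refine ⟨h.finite.insert p, ?_, ?_⟩
  · rintro q (rfl | hq) r (rfl | hr)
    · rw [inf_idem]; exact Or.inl rfl
    · exact hinf _ hr
    · rw [inf_comm]; exact hinf _ hq
    · exact Or.inr (h.inf_mem _ hq _ hr)
  · rintro q (rfl | hq) r (rfl | hr)
    · exact agree_self _
    · exact (hag _ hr).1
    · exact (hag _ hq).2
    · exact h.agree _ hq _ hr

/-- The new point has the same meets with `S` as `p`, so no further points arise. Towards elements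
incomparable with `p` it behaves like `p`, being above it; towards elements above `p` the hypothesis
`hext` applies. -/
theorem IsPartialIso.exists_insert_of_cone (hext : ExtendsCones J J' N M)
    (h : IsPartialIso J J' S) {p : N × M} (hp : p ∈ S) {c : N} (hpc : p.1 < c)
    (hc : ∀ q ∈ S, ¬p.1 < c ⊓ q.1) : ∃ d, IsPartialIso J J' (Insert.insert (c, d) S) := by
  obtain ⟨d, hpd, hd, hR⟩ := hext S h p hp c hpc hc
  have e1 : ∀ q ∈ S, c ⊓ q.1 = p.1 ⊓ q.1 := fun q hq =>
    IsConeTree.inf_eq_of_not_lt J J' hpc.le (hc q hq)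
  have e2 : ∀ q ∈ S, d ⊓ q.2 = p.2 ⊓ q.2 := fun q hq =>
    IsConeTree.inf_eq_of_not_lt J J' hpd.le (hd q hq)
  refine ⟨d, h.insert (fun q hq => Or.inr ?_) fun q hq => ?_⟩
  · have : (c, d) ⊓ q = p ⊓ q := Prod.ext (e1 q hq) (e2 q hq)
    rw [this]
    exact h.inf_mem p hp q hq
  have n1 : ¬c ≤ q.1 := fun hle =>
    hpc.not_ge ((inf_eq_left.2 hle).ge.trans ((e1 q hq).le.trans inf_le_left))
  have n2 : ¬d ≤ q.2 := fun hle =>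
    hpd.not_ge ((inf_eq_left.2 hle).ge.trans ((e2 q hq).le.trans inf_le_left))
  have l1 : q.1 ≤ c ↔ q.1 ≤ p.1 :=
    ⟨fun hle => (inf_eq_right.2 hle).ge.trans ((e1 q hq).le.trans inf_le_left),
      fun hle => hle.trans hpc.le⟩
  have l2 : q.2 ≤ d ↔ q.2 ≤ p.2 :=
    ⟨fun hle => (inf_eq_right.2 hle).ge.trans ((e2 q hq).le.trans inf_le_left),
      fun hle => hle.trans hpd.le⟩
  have hpq := h.agree p hp q hq
  have hqp := h.agree q hq p hp
  refine agree_of_incomparable (iff_of_false n1 n2) (l1.trans (hqp.le_iff.trans l2.symm)) ?_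
  intro j _ m1 _ m2
  by_cases hlt : p.1 < q.1
  · exact hR q hq hlt j
  have k1 : ¬q.1 ≤ p.1 := mt l1.2 m1
  have k1' : ¬p.1 ≤ q.1 := fun hle => k1 (eq_of_le_of_not_lt hle hlt).ge
  have k2 := mt hqp.le_iff.2 k1
  have k2' := mt hpq.le_iff.2 k1'
  constructor
  · rw [← IsConeTree.rel_iff_of_le_left j k1' k1 hpc.le,
      ← IsConeTree.rel_iff_of_le_left j k2' k2 hpd.le]
    exact hpq.rel_iff j
  · rw [← IsConeTree.rel_iff_of_le_right j k1 k1' hpc.le,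
      ← IsConeTree.rel_iff_of_le_right j k2 k2' hpd.le]
    exact hqp.rel_iff j

/-- The image is placed between the neighbours of `c` in `S`: the least `q` above it and the largest
element below it, if any. Meets of `c` with elements not above it, and the `R j` on elements
incomparable with it, are those of `q`. -/
theorem IsPartialIso.exists_insert_of_le [NoMinOrder M] [DenselyOrdered M]
    (h : IsPartialIso J J' S) {p : N × M} (hp : p ∈ S) {c : N} (hcp : c ≤ p.1) :
    ∃ d, IsPartialIso J J' (Insert.insert (c, d) S) := by
  by_cases hcS : ∃ d, (c, d) ∈ S
  · obtain ⟨d, hd⟩ := hcS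
    exact ⟨d, by rwa [Set.insert_eq_of_mem hd]⟩
  have hne : ∀ q ∈ S, q.1 ≠ c := fun q hq e => hcS ⟨q.2, e ▸ hq⟩
  have le_iff : ∀ q ∈ S, ∀ r ∈ S, (q ≤ r ↔ q.1 ≤ r.1) := fun q hq r hr =>
    ⟨fun hle => hle.1, fun hle => ⟨hle, (h.agree q hq r hr).le_iff.1 hle⟩⟩
  obtain ⟨q, hq⟩ : ∃ q, Minimal (· ∈ {q ∈ S | c ≤ q.1}) q :=
    (h.finite.subset (Set.sep_subset _ _)).exists_minimal ⟨p, hp, hcp⟩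
  have hqS : q ∈ S := hq.prop.1
  have hcq : c ≤ q.1 := hq.prop.2
  -- Minimal becomes least because `S` is closed under meets.
  have hleast : ∀ r ∈ S, c ≤ r.1 → q ≤ r := fun r hr hcr =>
    (hq.le_of_le ⟨h.inf_mem q hqS r hr, le_inf hcq hcr⟩ inf_le_left).trans inf_le_right
  obtain ⟨d, hdq, hd⟩ : ∃ d, d < q.2 ∧ ∀ r ∈ S, r.1 ≤ c → r.2 < d := by
    by_cases hlow : {r ∈ S | r.1 ≤ c}.Nonempty
    · obtain ⟨r, hr⟩ : ∃ r, Maximal (· ∈ {r ∈ S | r.1 ≤ c}) r :=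
        (h.finite.subset (Set.sep_subset _ _)).exists_maximal hlow
      have hrq : r.1 < q.1 := (lt_of_le_of_ne hr.prop.2 (hne r hr.prop.1)).trans_le hcq
      obtain ⟨d, hrd, hdq⟩ := exists_between
        (((h.agree r hr.prop.1 q hqS).lt_iff (h.agree q hqS r hr.prop.1)).1 hrq)
      refine ⟨d, hdq, fun r' hr' hle => lt_of_le_of_lt ?_ hrd⟩
      rcases IsConeTree.comparable J J' hle hr.prop.2 with hl | hl
      · exact (h.agree r' hr' r hr.prop.1).le_iff.1 hl
      · exact (hr.le_of_ge ⟨hr', hle⟩ ((le_iff _ hr.prop.1 _ hr').2 hl)).2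
    · obtain ⟨d, hd⟩ := exists_lt q.2
      exact ⟨d, hd, fun r hr hle => (hlow ⟨r, hr, hle⟩).elim⟩
  have up : ∀ r ∈ S, (c ≤ r.1 ↔ d ≤ r.2) := by
    intro r hr
    refine ⟨fun hcr => hdq.le.trans (hleast r hr hcr).2, fun hdr => ?_⟩
    rcases IsConeTree.comparable J J' hcq (inf_le_right : r.1 ⊓ q.1 ≤ q.1) with hl | hl
    · exact hl.trans inf_le_left
    · exact ((hd (r ⊓ q) (h.inf_mem r hr q hqS) hl).not_ge (le_inf hdr hdq.le)).elim
  have down : ∀ r ∈ S, (r.1 ≤ c ↔ r.2 ≤ d) := by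
    intro r hr
    refine ⟨fun hrc => (hd r hr hrc).le, fun hrd => ?_⟩
    rcases IsConeTree.comparable J J'
      ((h.agree r hr q hqS).le_iff.2 (hrd.trans hdq.le)) hcq with hl | hl
    · exact hl
    · exact (((hleast r hr hl).2.trans hrd).not_gt hdq).elim
  refine ⟨d, h.insert (fun r hr => ?_) fun r hr => ?_⟩
  · by_cases hcr : c ≤ r.1
    · exact Or.inl (inf_eq_left.2 ⟨hcr, (up r hr).1 hcr⟩)
    · have : (c, d) ⊓ r = q ⊓ r := Prod.ext (IsConeTree.inf_eq_of_not_le J J' hcq hcr)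
        (IsConeTree.inf_eq_of_not_le J J' hdq.le (mt (up r hr).2 hcr))
      rw [this]
      exact Or.inr (h.inf_mem q hqS r hr)
  · refine agree_of_incomparable (up r hr) (down r hr) fun j n1 m1 n2 m2 => ⟨?_, ?_⟩
    · rw [IsConeTree.rel_iff_of_le_left j n1 m1 hcq, IsConeTree.rel_iff_of_le_left j n2 m2 hdq.le]
      exact (h.agree q hqS r hr).rel_iff j
    · rw [IsConeTree.rel_iff_of_le_right j m1 n1 hcq, IsConeTree.rel_iff_of_le_right j m2 n2 hdq.le]
      exact (h.agree r hr q hqS).rel_iff j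

theorem IsPartialIso.exists_extension [Nonempty M] [NoMinOrder M] [DenselyOrdered M]
    (hext : ExtendsCones J J' N M) (h : IsPartialIso J J' S) (c : N) :
    ∃ S', S ⊆ S' ∧ IsPartialIso J J' S' ∧ ∃ d, (c, d) ∈ S' := by
  rcases S.eq_empty_or_nonempty with rfl | hS
  · obtain ⟨d⟩ := ‹Nonempty M›
    exact ⟨_, Set.subset_insert _ _, h.insert (p := (c, d)) (by simp) (by simp), d, Or.inl rfl⟩
  -- The meet `c ⊓ r.1` is chosen maximal and added first; by maximality `c` then lies in a new open
  -- cone above it.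
  obtain ⟨r, hr, hmax⟩ := h.finite.exists_maximalFor (fun q : N × M => c ⊓ q.1) S hS
  obtain ⟨d₀, h₀⟩ := h.exists_insert_of_le hr (inf_le_right : c ⊓ r.1 ≤ r.1)
  by_cases hcr : c ≤ r.1
  · rw [inf_eq_left.2 hcr] at h₀
    exact ⟨_, Set.subset_insert _ _, h₀, d₀, Or.inl rfl⟩
  obtain ⟨d, hd⟩ := h₀.exists_insert_of_cone hext (Or.inl rfl) (c := c) (inf_lt_left.2 hcr) (by
    rintro q (rfl | hq) hlt
    · exact hlt.not_ge inf_le_right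
    · exact hlt.not_ge (hmax hq hlt.le))
  exact ⟨_, (Set.subset_insert _ _).trans (Set.subset_insert _ _), hd, d, Or.inl rfl⟩

theorem IsPartialIso.realize_iff [Nonempty M] [NoMinOrder M] [DenselyOrdered M]
    [Nonempty N] [NoMinOrder N] [DenselyOrdered N] (h₁ : ExtendsCones J J' N M)
    (h₂ : ExtendsCones J J' M N) (hS : IsPartialIso J J' S) {α : Type*} {n : ℕ}
    (φ : (lang J J').BoundedFormula α n) (f : α → N × M) (xs : Fin n → N × M)
    (hf : ∀ a, f a ∈ S) (hxs : ∀ i, xs i ∈ S) :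
    φ.Realize (Prod.fst ∘ f) (Prod.fst ∘ xs) ↔ φ.Realize (Prod.snd ∘ f) (Prod.snd ∘ xs) := by
  have atomic : ∀ {n : ℕ} {φ : (lang J J').BoundedFormula α n} (_ : φ.IsAtomic) {S : Set (N × M)}
      (_ : IsPartialIso J J' S) (xs : Fin n → N × M) (_ : ∀ a, f a ∈ S) (_ : ∀ i, xs i ∈ S),
      φ.Realize (Prod.fst ∘ f) (Prod.fst ∘ xs) ↔ φ.Realize (Prod.snd ∘ f) (Prod.snd ∘ xs) := by
    intro n φ hφ S hS xs hf hxs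
    have hmem : ∀ t : (lang J J').Term (α ⊕ Fin n), pairVal (Sum.elim (Prod.fst ∘ f) (Prod.fst ∘ xs))
        (Sum.elim (Prod.snd ∘ f) (Prod.snd ∘ xs)) t ∈ S := by
      intro t
      induction t using Term.meet_induction with
      | var a => rcases a with a | i <;> [exact hf a; exact hxs i]
      | meet s t hs ht => rw [pairVal_meetT]; exact hS.inf_mem _ hs _ ht
    exact realize_atomic_iff_of_agree (fun s t => hS.agree _ (hmem s) _ (hmem t)) hφ
  induction φ generalizing S with
  | falsum => exact Iff.rfl
  | equal t₁ t₂ => exact atomic (.equal t₁ t₂) hS xs hf hxs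
  | rel R ts => exact atomic (.rel R ts) hS xs hf hxs
  | imp _ _ ih1 ih2 => exact imp_congr (ih1 hS xs hf hxs) (ih2 hS xs hf hxs)
  | all φ ih =>
    have step : ∀ S', S ⊆ S' → IsPartialIso J J' S' → ∀ p ∈ S',
        (φ.Realize (Prod.fst ∘ f) (Fin.snoc (Prod.fst ∘ xs) p.1) ↔
          φ.Realize (Prod.snd ∘ f) (Fin.snoc (Prod.snd ∘ xs) p.2)) := by
      intro S' hSS' hS' p hp
      rw [← Fin.comp_snoc, ← Fin.comp_snoc]
      refine ih hS' _ (fun a => hSS' (hf a)) fun i => ?_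
      induction i using Fin.lastCases with
      | last => simpa using hp
      | cast i => simpa using hSS' (hxs i)
    rw [BoundedFormula.realize_all, BoundedFormula.realize_all]
    constructor
    · intro hall d
      obtain ⟨S', hSS', hS', c, hc⟩ := hS.swap.exists_extension h₂ d
      refine (step (Prod.swap '' S') ?_ hS'.swap (c, d) ⟨_, hc, rfl⟩).1 (hall c)
      intro p hp
      exact ⟨p.swap, hSS' ⟨p, hp, rfl⟩, rfl⟩
    · intro hall c
      obtain ⟨S', hSS', hS', d, hd⟩ := hS.exists_extension h₁ c
      exact (step S' hSS' hS' (c, d) hd).2 (hall d)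

omit [IsEmpty J'] in
-- Finiteness holds because every term takes the value of a meet of two variables.
theorem isPartialIso_range_pairVal {k : ℕ} {f : Fin k → N} {g : Fin k → M}
    (h : ∀ φ : (lang J J').Formula (Fin k), BoundedFormula.IsAtomic φ →
      (φ.Realize f ↔ φ.Realize g)) :
    IsPartialIso J J' (Set.range (pairVal (J := J) (J' := J') f g)) := by
  refine ⟨?_, ?_, ?_⟩
  · refine (Set.finite_range fun p : Fin k × Fin k => (f p.1 ⊓ f p.2, g p.1 ⊓ g p.2)).subset ?_
    rintro _ ⟨t, rfl⟩
    obtain ⟨a, b, hab⟩ := exists_realize_eq_inf f t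
    refine ⟨(a, b), ?_⟩
    have := (agree_pairVal h t (meetT (Term.var a) (Term.var b))).eq_of_fst_eq
      (agree_pairVal h _ _) (by simpa [pairVal] using hab)
    rw [this, pairVal_meetT]
    rfl
  · rintro _ ⟨s, rfl⟩ _ ⟨t, rfl⟩
    exact ⟨meetT s t, pairVal_meetT _ _ _ _⟩
  · rintro _ ⟨s, rfl⟩ _ ⟨t, rfl⟩
    exact agree_pairVal h s t

end BackAndForth

/-! ### Dense meet-trees and dense meet-trees with random graphs -/

section Axioms

variable {J : Type u} {J' : Type v} {M : Type w} [SemilatticeInf M] [(lang J J').Structure M]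

variable (J J') in
theorem noMinOrder_of_densityAxioms [IsConeTree J J' M] (h : M ⊨ densityAxioms J J') :
    NoMinOrder M := by
  refine ⟨fun a => ?_⟩
  have := (Theory.model_iff _).1 h _ (Or.inl rfl)
  simp [Sentence.Realize, Formula.Realize, ltF, BoundedFormula.realize_rel₂, Fin.snoc,
    IsConeTree.relMap_lt] at this
  exact this a

variable (J J') in
theorem denselyOrdered_of_densityAxioms [IsConeTree J J' M] (h : M ⊨ densityAxioms J J') :
    DenselyOrdered M := by
  refine ⟨fun a b hab => ?_⟩
  have := (Theory.model_iff _).1 h _ (Or.inr rfl)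
  simp [Sentence.Realize, Formula.Realize, ltF, BoundedFormula.realize_rel₂, Fin.snoc,
    IsConeTree.relMap_lt] at this
  exact this a b hab

variable [IsConeTree J J' M]

theorem realize_ltF {α : Type*} {n : ℕ} (s t : (lang J J').Term (α ⊕ Fin n)) (f : α → M)
    (xs : Fin n → M) :
    (ltF s t).Realize f xs ↔ s.realize (Sum.elim f xs) < t.realize (Sum.elim f xs) := by
  rw [ltF, BoundedFormula.realize_rel₂, IsConeTree.relMap_lt]

theorem exists_cones_of_manyCones {n : ℕ} (h : M ⊨ manyCones J J' n) (a : M) :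
    ∃ x : Fin n → M, (∀ i, a < x i) ∧ ∀ i k, i ≠ k → ¬a < x i ⊓ x k := by
  simp only [Sentence.Realize, manyCones, Formula.realize_iAlls, Formula.realize_iExs] at h
  obtain ⟨x, hx⟩ := h fun _ => a
  refine ⟨x, ?_⟩
  simpa [Formula.Realize, realize_ltF, fv] using hx

end Axioms

/-! ### New open cones in dense meet-trees -/

section DMT

variable {M N : Type w} [SemilatticeInf M] [Lmt.Structure M] [SemilatticeInf N] [Lmt.Structure N]
  [IsConeTree Empty Empty M]

theorem extendsCones_dmt (h : M ⊨ DMT) : ExtendsCones Empty Empty N M := by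
  intro S hS p hp c hpc hc
  have := hS.finite.fintype
  -- Each element of `S` meets at most one open cone above `p.2`, so one cone more than there are
  -- elements leaves a free one.
  obtain ⟨x, hx, hx'⟩ := exists_cones_of_manyCones (n := Fintype.card S + 1)
    ((Theory.model_iff _).1 h _ (Or.inr ⟨_, rfl⟩)) p.2
  obtain ⟨i, hi⟩ : ∃ i, ∀ q ∈ S, ¬p.2 < x i ⊓ q.2 := by
    by_contra hcon
    push Not at hcon
    choose q hqS hq using hcon
    have hinj : Function.Injective fun i => (⟨q i, hqS i⟩ : S) := by
      intro i k hik
      by_contra hne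
      have hik' : q i = q k := congrArg Subtype.val hik
      refine hx' i k hne ?_
      have h1 := hq i
      have h2 := hq k
      rw [← hik'] at h2
      rcases IsConeTree.comparable Empty Empty (inf_le_right : x i ⊓ (q i).2 ≤ (q i).2)
        (inf_le_right : x k ⊓ (q i).2 ≤ (q i).2) with hl | hl
      · exact h1.trans_le (le_inf inf_le_left (hl.trans inf_le_left))
      · exact h2.trans_le (le_inf (hl.trans inf_le_left) inf_le_left)
    have := Fintype.card_le_of_injective _ hinj
    simp at this
  exact ⟨x i, hx i, hi, fun q _ _ j => j.elim⟩

end DMT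

/-! ### New open cones with random graphs -/

section DTR

variable {M N : Type w} [SemilatticeInf M] [(lang Unit Empty).Structure M] [SemilatticeInf N]
  [(lang Unit Empty).Structure N] [IsConeTree Unit Empty M] [IsConeTree Unit Empty N]

theorem relOn_symm_of_symmAxiom {M : Type*} [(lang Unit Empty).Structure M] (h : M ⊨ symmAxiom) (a b : M) :
    relOn Empty () a b ↔ relOn Empty () b a := by
  simp [symmAxiom, Sentence.Realize, Formula.Realize, relF, BoundedFormula.realize_rel₂,
    Fin.snoc] at h
  exact ⟨h a b, h b a⟩

theorem exists_cone_of_randomConesAxiom {n m : ℕ} (h : M ⊨ randomConesAxiom n m) (g : M)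
    (x : Fin n → M) (y : Fin m → M) (hx : ∀ i, g < x i) (hy : ∀ k, g < y k)
    (hxy : ∀ i k, ¬g < x i ⊓ y k) :
    ∃ z, g < z ∧ (∀ i, ¬g < z ⊓ x i ∧ relOn Empty () z (x i)) ∧
      ∀ k, ¬g < z ⊓ y k ∧ ¬relOn Empty () z (y k) := by
  simp only [Sentence.Realize, randomConesAxiom, Formula.realize_iAlls, Formula.realize_imp,
    Formula.realize_iExs] at h
  have := h (Sum.elim (fun _ => g) (Sum.elim x y)) ?_
  · obtain ⟨z, hz⟩ := this
    refine ⟨z (), ?_⟩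
    simpa [Formula.Realize, realize_ltF, fv, relF, BoundedFormula.realize_rel₂, relOn] using hz
  · simpa [Formula.Realize, realize_ltF, fv] using ⟨hx, hy, hxy⟩

theorem exists_fin_range_eq {α : Type*} {s : Set α} (hs : s.Finite) :
    ∃ (n : ℕ) (e : Fin n → α), Set.range e = s := by
  have := hs.fintype
  exact ⟨_, fun i => ((Fintype.equivFin s).symm i : α), by
    rw [Set.range_comp' Subtype.val, Equiv.range_eq_univ]; simp⟩

/-- The elements of `S` above `p` are split into those related to `c` and those not; the extension
axiom yields a cone with the same pattern. Symmetry gives the reversed relation. -/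
theorem extendsCones_dtr (h : M ⊨ DTR) (h' : N ⊨ DTR) : ExtendsCones Unit Empty N M := by
  intro S hS p hp c hpc hc
  have symmM := relOn_symm_of_symmAxiom ((Theory.model_iff _).1 h _ (Or.inl (Or.inr rfl)))
  have symmN := relOn_symm_of_symmAxiom ((Theory.model_iff _).1 h' _ (Or.inl (Or.inr rfl)))
  have lt_iff : ∀ q ∈ S, (p.1 < q.1 ↔ p.2 < q.2) := fun q hq =>
    (hS.agree p hp q hq).lt_iff (hS.agree q hq p hp)
  obtain ⟨n, x, hx⟩ := exists_fin_range_eq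
    (hS.finite.subset (Set.sep_subset S fun q => p.1 < q.1 ∧ relOn Empty () c q.1))
  obtain ⟨m, y, hy⟩ := exists_fin_range_eq
    (hS.finite.subset (Set.sep_subset S fun q => p.1 < q.1 ∧ ¬relOn Empty () c q.1))
  have hx' : ∀ i, x i ∈ S ∧ p.1 < (x i).1 ∧ relOn Empty () c (x i).1 := fun i =>
    hx.le ⟨i, rfl⟩
  have hy' : ∀ i, y i ∈ S ∧ p.1 < (y i).1 ∧ ¬relOn Empty () c (y i).1 := fun i =>
    hy.le ⟨i, rfl⟩
  obtain ⟨d, hpd, hdx, hdy⟩ := exists_cone_of_randomConesAxiom (n := n) (m := m)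
    ((Theory.model_iff _).1 h _ (Or.inr ⟨n, m, rfl⟩)) p.2 (fun i => (x i).2) (fun i => (y i).2)
    (fun i => (lt_iff _ (hx' i).1).1 (hx' i).2.1) (fun i => (lt_iff _ (hy' i).1).1 (hy' i).2.1)
    -- A related and an unrelated element cannot share a cone: their meet is in `S`, so they would
    -- share one in `N` too, and `R` does not distinguish points of the same cone.
    (fun i k hlt => by
      have hlt' : p.1 < (x i).1 ⊓ (y k).1 :=
        (lt_iff _ (hS.inf_mem _ (hx' i).1 _ (hy' k).1)).2 hlt
      obtain ⟨hxS, hpx, hR⟩ := hx' i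
      have e : c ⊓ (x i).1 = p.1 := by
        rw [IsConeTree.inf_eq_of_not_lt Unit Empty hpc.le (hc _ hxS), inf_eq_left.2 hpx.le]
      obtain ⟨n1, n2⟩ := IsConeTree.not_le_of_rel hR
      refine (hy' k).2.2 ((IsConeTree.rel_congr () n1 n2 ?_ ?_).1 hR)
      · rwa [e, inf_idem]
      · rwa [e])
  have main : ∀ q ∈ S, p.1 < q.1 →
      ¬p.2 < d ⊓ q.2 ∧ (relOn Empty () c q.1 ↔ relOn Empty () d q.2) := by
    intro q hq hpq
    by_cases hR : relOn Empty () c q.1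
    · obtain ⟨i, rfl⟩ := hx.ge ⟨hq, hpq, hR⟩
      exact ⟨(hdx i).1, iff_of_true hR (hdx i).2⟩
    · obtain ⟨i, rfl⟩ := hy.ge ⟨hq, hpq, hR⟩
      exact ⟨(hdy i).1, iff_of_false hR (hdy i).2⟩
  refine ⟨d, hpd, fun q hq hlt => ?_, fun q hq hpq j => ⟨(main q hq hpq).2, ?_⟩⟩
  · exact (main q hq ((lt_iff q hq).2 (hlt.trans_le inf_le_right))).1 hlt
  · rw [symmN, symmM]
    exact (main q hq hpq).2

end DTR

/-! ### Conclusion for `DMT` and `DTR` -/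

section

variable {J : Type u} {J' : Type v}

/-- Theories of dense meet-trees without unary predicates in which new open cones can be chosen
freely satisfy the strong form of weak binarity. -/
theorem isWeaklyBinaryForAllTuples_of_extendsCones [IsEmpty J'] {T : (lang J J').Theory}
    (htree : meetTreeAxioms J J' ⊆ T) (hdense : densityAxioms J J' ⊆ T)
    (hcones : ∀ (M : Type (max u v w)) [(lang J J').Structure M], M ⊨ T →
      M ⊨ onOpenConesAxioms J J')
    (hext : ∀ (N M : Type (max u v w)) [SemilatticeInf N] [(lang J J').Structure N]
      [SemilatticeInf M] [(lang J J').Structure M], IsConeTree J J' N → IsConeTree J J' M →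
      N ⊨ T → M ⊨ T → ExtendsCones J J' N M) :
    IsWeaklyBinaryForAllTuples.{0, max u v, w} T := by
  have tree : ∀ (M : Type (max u v w)) [(lang J J').Structure M], Nonempty M → M ⊨ T →
      ∃ _ : SemilatticeInf M, IsConeTree J J' M := fun M _ _ hM =>
    exists_isConeTree (hM.mono htree) (hcones M hM)
  refine isWeaklyBinaryForAllTuples_of_atomicTypesDecide ?_ tree
  intro N M _ _ _ _ hN hM k f g hat φ
  obtain ⟨_, hNt⟩ := tree N ‹_› hN
  obtain ⟨_, hMt⟩ := tree M ‹_› hM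
  have := noMinOrder_of_densityAxioms J J' (hN.mono hdense)
  have := noMinOrder_of_densityAxioms J J' (hM.mono hdense)
  have := denselyOrdered_of_densityAxioms J J' (hN.mono hdense)
  have := denselyOrdered_of_densityAxioms J J' (hM.mono hdense)
  -- The back-and-forth starts from the substructures generated by the two tuples.
  have := (isPartialIso_range_pairVal hat).realize_iff (hext N M hNt hMt hN hM)
    (hext M N hMt hNt hM hN) φ (fun i => (f i, g i)) Fin.elim0
    (fun i => ⟨Term.var i, rfl⟩) (fun i => i.elim0)
  rwa [Subsingleton.elim (Prod.fst ∘ Fin.elim0) (default : Fin 0 → N),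
    Subsingleton.elim (Prod.snd ∘ Fin.elim0) (default : Fin 0 → M)] at this

end

theorem isWeaklyBinaryForAllTuples_dmt : IsWeaklyBinaryForAllTuples.{0, 0, w} DMT := by
  refine isWeaklyBinaryForAllTuples_of_extendsCones.{0, 0, w} (fun _ h => Or.inl (Or.inl h))
    (fun _ h => Or.inl (Or.inr h)) (fun M _ _ => ?_) fun _ _ _ _ _ _ _ _ _ hM => extendsCones_dmt hM
  refine (Theory.model_iff _).2 ?_
  rintro _ (⟨j, -⟩ | ⟨j, -⟩) <;> exact j.elim

theorem isWeaklyBinaryForAllTuples_dtr : IsWeaklyBinaryForAllTuples.{0, 0, w} DTR :=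
  isWeaklyBinaryForAllTuples_of_extendsCones.{0, 0, w}
    (fun _ h => Or.inl (Or.inl (Or.inl (Or.inl (Or.inl h)))))
    (fun _ h => Or.inl (Or.inl (Or.inl (Or.inl (Or.inr h)))))
    (fun _ _ hM => hM.mono fun _ h => Or.inl (Or.inl (Or.inr h)))
    fun _ _ _ _ _ _ _ _ hN hM => extendsCones_dtr hM hN

end ConeExpansion

theorem theorem2 :
    (∀ (J : Type u) (J' : Type v) (T : (ConeExpansion.lang J J').Theory),
      ConeExpansion.IsBinaryConeExpansion T →
        ConeExpansion.IsWeaklyBinary.{0, max u v, w} T ∧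
        ConeExpansion.IsWeaklyBinaryForAllTuples.{0, max u v, w} T) ∧
    (ConeExpansion.IsWeaklyBinary.{0, 0, w} ConeExpansion.DMT ∧
      ConeExpansion.IsWeaklyBinaryForAllTuples.{0, 0, w} ConeExpansion.DMT) ∧
    (ConeExpansion.IsWeaklyBinary.{0, 0, w} ConeExpansion.DTR ∧
      ConeExpansion.IsWeaklyBinaryForAllTuples.{0, 0, w} ConeExpansion.DTR) := by
  refine ⟨fun J J' T h => ?_, ?_, ?_⟩
  · have := h.isWeaklyBinaryForAllTuples
    exact ⟨this.isWeaklyBinary, this⟩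
  · have := ConeExpansion.isWeaklyBinaryForAllTuples_dmt
    exact ⟨this.isWeaklyBinary, this⟩
  · have := ConeExpansion.isWeaklyBinaryForAllTuples_dtr
    exact ⟨this.isWeaklyBinary, this⟩
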